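/- Let $m,\omega,\sigma>0$ and $\hbar=1$. In $\mathcal H=L^2_{\mathbb C}(\mathbb R,dx)$ let $H=\frac{1}{2m}P^2+\frac{m\omega^2}{2}Q^2=\sum_n E_n|\phi_n\rangle\langle\phi_n|$ be the self-adjoint Hamiltonian of the harmonic oscillator, where $E_n=\omega(n+\tfrac12)$, the $\phi_n$ are the normalized Hermite functions $\phi_n(x)=(n!)^{-1/2}(2\pi s^2)^{-1/4}\mathrm{He}_n(x/s)\,e^{-x^2/(4s^2)}$ with $s=1/\sqrt{2m\omega}$, and $D(H)=\{\psi\in\mathcal H: \sum_n E_n^2|\langle\phi_n|\psi\rangle|^2<\infty\}$. Let $\mathcal T_s(\mathcal H)$ be the self-adjoint trace-class operators with the trace norm, $K(\mathcal H)\subset\mathcal T_s(\mathcal H)$ the positive operators of trace $1$, $\tau_tV=e^{-iHt}Ve^{iHt}$, and $Z$ the infinitesimal generator of $(\tau_t)_{t\in\mathbb R}$ on $\mathcal T_s(\mathcal H)$ (derivative at $t=0$ in trace norm), with domain $D(Z)$. Put $u^\sigma(x)=(2\pi\sigma^2)^{-1/4}e^{-x^2/(4\sigma^2)}$, $u^\sigma_{qp}(x)=e^{ipx}u^\sigma(x-q)$,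 and for $V\in\mathcal T_s(\mathcal H)$ $$(\hat TV)(q,p)=\frac1{2\pi}\,\mathrm{tr}\big(V\,|u^\sigma_{qp}\rangle\langle u^\sigma_{qp}|\big),\qquad (q,p)\in\mathbb R^2 .$$ The map $\hat T:\mathcal T_s(\mathcal H)\to L^1_{\mathbb R}(\mathbb R^2,dq\,dp)$ is injective; put $\hat L=\hat TZ\hat T^{-1}$ with $D(\hat L)=\hat TD(Z)$, and, for $\rho\in\hat TK(\mathcal H)$ and $t\in\mathbb R$, $\rho_t=\hat T\tau_t\hat T^{-1}\rho$. Finally let $H(q,p)=\frac{p^2}{2m}+\frac{m\omega^2}{2}q^2$ be the classical Hamiltonian, $\Phi_t$ its Hamiltonian flow, i.e. the flow of $\dot q=\partial H/\partial p$, $\dot p=-\partial H/\partial q$, and $\{f,g\}=\frac{\partial f}{\partial p}\frac{\partial g}{\partial q}-\frac{\partial f}{\partial q}\frac{\partial g}{\partial p}$. Then: (a) If $W=\sum_{i=1}^n\alpha_i|\psi_i\rangle\langle\psi_i|$ with $\alpha_i\ge0$, $\sum_i\alpha_i=1$, $\psi_i\in D(H)$ and $\|\psi_i\|=1$, then $\rho=\hat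 TW\in D(\hat L)\cap C^\infty(\mathbb R^2)$ and $$\hat L\rho=-\{H,\rho\}+\Big(m\omega^2\sigma^2-\frac1{4m\sigma^2}\Big)\frac{\partial^2\rho}{\partial q\,\partial p}.$$ Moreover, for every $t\in\mathbb R$, $\rho_t\in D(\hat L)\cap C^\infty(\mathbb R^2)$ satisfies the same formula for $\hat L\rho_t$, and $$\dot\rho_t=-\{H,\rho_t\}+\Big(m\omega^2\sigma^2-\frac1{4m\sigma^2}\Big)\frac{\partial^2\rho_t}{\partial q\,\partial p},$$ where $\dot\rho_t$ is the derivative in $L^1(\mathbb R^2)$-norm (both $\rho_t$ and the right-hand side being integrable). (b) If $\sigma=\frac1{\sqrt{2m\omega}}$, then $\rho_t=\rho\circ\Phi_t^{-1}$ for every $\rho\in\hat TK(\mathcal H)$ and every $t\in\mathbb R$, and for every $\rho\in\hat TK(\mathcal H)\cap C^\infty(\mathbb R^2)$ the classical Liouville equation $$\frac{\partial\rho_t}{\partial t}(q,p)=-\{H,\rho_t\}(q,p)$$ holds for all $t\in\mathbb R$ and all $(q,p)\in\mathbb R^2$, with the usual pointwise partial derivative. -/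

import Mathlib

open MeasureTheory Filter Topology InnerProductSpace Polynomial
open scoped ENNReal

noncomputable section

namespace PhaseSpace

/-! ### Trace-class operators and states of a complex Hilbert space -/

section TraceClass

variable {E : Type*} [NormedAddCommGroup E] [InnerProductSpace ℂ E] [CompleteSpace E]

/-- Index set of a fixed orthonormal basis of the Hilbert space `E`. -/
def basisIndex (E : Type*) [NormedAddCommGroup E] [InnerProductSpace ℂ E] [CompleteSpace E] :
    Set E :=
  (exists_hilbertBasis ℂ E).choose

/-- A fixed orthonormal (Hilbert) basis of `E`. -/
def basis (E : Type*) [NormedAddCommGroup E] [InnerProductSpace ℂ E] [CompleteSpace E] :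
    HilbertBasis (basisIndex E) ℂ E :=
  (exists_hilbertBasis ℂ E).choose_spec.choose

/-- The trace norm `‖A‖_tr = tr |A| ∈ [0, ∞]`, with `|A| = (A* A)^{1/2}`. -/
def traceNorm (A : E →L[ℂ] E) : ℝ≥0∞ :=
  ∑' i, ENNReal.ofReal (⟪basis E i, CFC.abs A (basis E i)⟫_ℂ).re

/-- The trace `tr A = ∑ ⟨b i, A (b i)⟩` (for trace-class `A` it does not depend on the basis). -/
def trace (A : E →L[ℂ] E) : ℂ :=
  ∑' i, ⟪basis E i, A (basis E i)⟫_ℂ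

/-- The real vector space `T_s(E)` of self-adjoint trace-class operators. -/
def selfAdjointTraceClass (E : Type*) [NormedAddCommGroup E] [InnerProductSpace ℂ E]
    [CompleteSpace E] : Set (E →L[ℂ] E) :=
  {V | IsSelfAdjoint V ∧ traceNorm V < ∞}

/-- The convex set `K(E)` of density operators: positive trace-class operators of trace one. -/
def states (E : Type*) [NormedAddCommGroup E] [InnerProductSpace ℂ E] [CompleteSpace E] :
    Set (E →L[ℂ] E) :=
  {W | W.IsPositive ∧ traceNorm W < ∞ ∧ trace W = 1}

/-- The graph of the infinitesimal generator `Z` of a one-parameter group `τ` acting on `T_s(E)`: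
`V ∈ D(Z)` and `Z V = V'`, i.e. `(τ_t V - V) / t → V'` in trace norm as `t → 0`. -/
def GeneratorGraph (τ : ℝ → (E →L[ℂ] E) → (E →L[ℂ] E)) (V V' : E →L[ℂ] E) : Prop :=
  V ∈ selfAdjointTraceClass E ∧ V' ∈ selfAdjointTraceClass E ∧
    Tendsto (fun t : ℝ => traceNorm (((t : ℂ)⁻¹) • (τ t V - V) - V')) (𝓝[≠] 0) (𝓝 0)

end TraceClass

/-! ### Operators that are diagonal in an orthonormal system -/

section Diagonal

lemma diagonal_sum_le {E : Type*} [NormedAddCommGroup E] [InnerProductSpace ℂ E] {v : ℕ → E} (hv : Orthonormal ℂ v) (c : ℕ → ℂ) (hc : ∀ n, ‖c n‖ ≤ 1)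
    (x : E) (s : Finset ℕ) :
    ‖∑ n ∈ s, (c n * ⟪v n, x⟫_ℂ) • v n‖ ^ 2 ≤ ∑ n ∈ s, ‖⟪v n, x⟫_ℂ‖ ^ 2 := by
  have h := hv.orthogonalFamily.norm_sum (fun n => c n * ⟪v n, x⟫_ℂ) s
  simp only [LinearIsometry.toSpanSingleton_apply] at h
  rw [h]
  refine Finset.sum_le_sum fun n _ => ?_
  rw [norm_mul]
  have : ‖c n‖ * ‖⟪v n, x⟫_ℂ‖ ≤ ‖⟪v n, x⟫_ℂ‖ := mul_le_of_le_one_left (norm_nonneg _) (hc n)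
  gcongr

variable {E : Type*} [NormedAddCommGroup E] [InnerProductSpace ℂ E] [CompleteSpace E]

lemma diagonal_summable {v : ℕ → E} (hv : Orthonormal ℂ v) (c : ℕ → ℂ) (hc : ∀ n, ‖c n‖ ≤ 1)
    (x : E) : Summable fun n => (c n * ⟪v n, x⟫_ℂ) • v n := by
  have h := hv.orthogonalFamily.summable_iff_norm_sq_summable (fun n => c n * ⟪v n, x⟫_ℂ)
  simp only [LinearIsometry.toSpanSingleton_apply] at h
  refine h.2 (Summable.of_nonneg_of_le (fun _ => by positivity) (fun n => ?_)
    (hv.inner_products_summable x))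
  rw [norm_mul]
  have : ‖c n‖ * ‖⟪v n, x⟫_ℂ‖ ≤ ‖⟪v n, x⟫_ℂ‖ := mul_le_of_le_one_left (norm_nonneg _) (hc n)
  gcongr

/-- The bounded operator `x ↦ ∑ n, c n ⟨v n, x⟩ v n`, for `v` orthonormal and `|c n| ≤ 1`. -/
def diagonal {v : ℕ → E} (hv : Orthonormal ℂ v) (c : ℕ → ℂ) (hc : ∀ n, ‖c n‖ ≤ 1) :
    E →L[ℂ] E :=
  LinearMap.mkContinuous
    { toFun := fun x => ∑' n, (c n * ⟪v n, x⟫_ℂ) • v n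
      map_add' := fun x y => by
        rw [← (diagonal_summable hv c hc x).tsum_add (diagonal_summable hv c hc y)]
        congr 1
        funext n
        rw [inner_add_right, mul_add, add_smul]
      map_smul' := fun a x => by
        rw [RingHom.id_apply, ← (diagonal_summable hv c hc x).tsum_const_smul a]
        congr 1
        funext n
        rw [inner_smul_right, smul_smul]
        congr 1
        ring }
    1 fun x => by
      rw [one_mul]
      refine le_of_tendsto (diagonal_summable hv c hc x).hasSum.norm
        (Eventually.of_forall fun s => ?_)
      exact (sq_le_sq₀ (norm_nonneg _) (norm_nonneg _)).1 ((diagonal_sum_le hv c hc x s).trans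
        (hv.sum_inner_products_le x))

end Diagonal

/-! ### The Hilbert space `L²(ℝ, dx)` and the Hermite functions -/

/-- The Hilbert space `L²(ℝ, dx)` of complex wave functions. -/
abbrev L2R : Type := Lp ℂ 2 (volume : Measure ℝ)

/-- The `n`-th Hermite function of length scale `s`,
`(n!)^{-1/2} (2 π s²)^{-1/4} He_n(x / s) exp(-x² / (4 s²))`, where `He_n` is the `n`-th
(probabilists') Hermite polynomial.  For `s = 1 / √(2 m ω)` these are the normalized energy
eigenfunctions of the harmonic oscillator with mass `m` and frequency `ω` (`ℏ = 1`). -/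
def hermiteFun (s : ℝ) (n : ℕ) (x : ℝ) : ℝ :=
  (√(n.factorial : ℝ))⁻¹ * ((2 * Real.pi * s ^ 2) ^ (1 / 4 : ℝ))⁻¹ *
    aeval (x / s) (hermite n) * Real.exp (-(x ^ 2 / (4 * s ^ 2)))

lemma integrable_poly_gauss (p : ℝ[X]) :
    Integrable (fun x : ℝ => p.eval x * Real.exp (-(x ^ 2 / 2))) := by
  induction p using Polynomial.induction_on' with
  | add p q hp hq =>
    refine (hp.add hq).congr (Eventually.of_forall fun x => ?_)
    change _ = (p + q).eval x * _
    rw [eval_add, add_mul]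
    rfl
  | monomial n a =>
    have h := integrable_rpow_mul_exp_neg_mul_sq (b := 1 / 2) (by norm_num) (s := (n : ℝ))
      (by linarith [n.cast_nonneg (α := ℝ)])
    refine (h.const_mul a).congr (Eventually.of_forall fun x => ?_)
    change a * (x ^ (n : ℝ) * _) = (monomial n a).eval x * _
    rw [Real.rpow_natCast, eval_monomial, mul_assoc]
    congr 3
    ring

lemma integral_hermite_succ (n : ℕ) (p : ℝ[X]) :
    ∫ x : ℝ, (((hermite (n + 1)).map (Int.castRingHom ℝ)) * p).eval x * Real.exp (-(x ^ 2 / 2)) =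
    ∫ x : ℝ, (((hermite n).map (Int.castRingHom ℝ)) * derivative p).eval x *
      Real.exp (-(x ^ 2 / 2)) := by
  rw [← sub_eq_zero, ← integral_sub (integrable_poly_gauss _) (integrable_poly_gauss _)]
  set h := (hermite n).map (Int.castRingHom ℝ) with hh
  have hs : (hermite (n + 1)).map (Int.castRingHom ℝ) = X * h - derivative h := by
    rw [hermite_succ, Polynomial.map_sub, Polynomial.map_mul, map_X, derivative_map]
  have key := integral_eq_zero_of_hasDerivAt_of_integrable
    (f := fun x : ℝ => (-(h * p)).eval x * Real.exp (-(x ^ 2 / 2)))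
    (f' := fun x : ℝ => (X * h * p - derivative (h * p)).eval x * Real.exp (-(x ^ 2 / 2)))
    (fun x => by
      have h1 := (-(h * p)).hasDerivAt x
      have h2 : HasDerivAt (fun y : ℝ => Real.exp (-(y ^ 2 / 2)))
          (Real.exp (-(x ^ 2 / 2)) * (-x)) x := by
        have h3 : HasDerivAt (fun y : ℝ => -(y ^ 2 / 2)) (-x) x := by
          refine (((hasDerivAt_id x).pow 2).div_const 2).neg.congr_deriv ?_
          simp
        exact h3.exp
      refine (h1.mul h2).congr_deriv ?_
      simp only [derivative_neg, derivative_mul, eval_neg, eval_sub, eval_add, eval_mul, eval_X]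
      ring)
    (integrable_poly_gauss _) (integrable_poly_gauss _)
  rw [← key]
  congr 1
  funext x
  rw [hs]
  simp
  ring

lemma integral_hermite_mul (n : ℕ) (p : ℝ[X]) :
    ∫ x : ℝ, (((hermite n).map (Int.castRingHom ℝ)) * p).eval x * Real.exp (-(x ^ 2 / 2)) =
    ∫ x : ℝ, (derivative^[n] p).eval x * Real.exp (-(x ^ 2 / 2)) := by
  induction n generalizing p with
  | zero => simp [hermite_zero]
  | succ n ih => rw [integral_hermite_succ, ih, Function.iterate_succ_apply]

lemma integral_hermite_hermite (n k : ℕ) (hkn : k ≤ n) :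
    ∫ x : ℝ, (((hermite n).map (Int.castRingHom ℝ)) *
      ((hermite k).map (Int.castRingHom ℝ))).eval x * Real.exp (-(x ^ 2 / 2)) =
    if n = k then (n.factorial : ℝ) * √(2 * Real.pi) else 0 := by
  rw [integral_hermite_mul]
  split_ifs with h
  · subst h
    have hd : derivative^[n] ((hermite n).map (Int.castRingHom ℝ)) = C (n.factorial : ℝ) := by
      have hdeg : (derivative^[n] ((hermite n).map (Int.castRingHom ℝ))).natDegree = 0 := by
        have := natDegree_iterate_derivative ((hermite n).map (Int.castRingHom ℝ)) n
        rw [(hermite_monic n).natDegree_map, natDegree_hermite] at this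
        omega
      rw [eq_C_of_natDegree_eq_zero hdeg, coeff_iterate_derivative]
      simp [coeff_hermite_self, Nat.descFactorial_self]
    have hg := integral_gaussian (1 / 2)
    simp only [hd, eval_C]
    rw [integral_const_mul]
    congr 1
    rw [show 2 * Real.pi = Real.pi / (1 / 2) by ring, ← hg]
    congr 1
    funext x
    congr 1
    ring
  · rw [iterate_derivative_eq_zero]
    · simp
    · rw [(hermite_monic k).natDegree_map, natDegree_hermite]
      omega

lemma hermiteFun_mul {s : ℝ} (hs : s ≠ 0) (n k : ℕ) (x : ℝ) :
    hermiteFun s n x * hermiteFun s k x =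
      ((√(n.factorial : ℝ))⁻¹ * (√(k.factorial : ℝ))⁻¹ * (√(2 * Real.pi * s ^ 2))⁻¹) *
      ((((hermite n).map (Int.castRingHom ℝ)) *
        ((hermite k).map (Int.castRingHom ℝ))).eval (x / s) * Real.exp (-((x / s) ^ 2 / 2))) := by
  have h1 : (√(2 * Real.pi * s ^ 2))⁻¹ = ((2 * Real.pi * s ^ 2) ^ (1 / 4 : ℝ))⁻¹ *
      ((2 * Real.pi * s ^ 2) ^ (1 / 4 : ℝ))⁻¹ := by
    rw [← mul_inv, ← Real.rpow_add (by positivity), Real.sqrt_eq_rpow]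
    norm_num
  have h2 : Real.exp (-((x / s) ^ 2 / 2)) =
      Real.exp (-(x ^ 2 / (4 * s ^ 2))) * Real.exp (-(x ^ 2 / (4 * s ^ 2))) := by
    rw [← Real.exp_add]
    congr 1
    field_simp
    ring
  have h3 : ∀ j : ℕ, ((hermite j).map (Int.castRingHom ℝ)).eval (x / s) =
      aeval (x / s) (hermite j) := fun j => by
    rw [eval_map, aeval_def]
    rfl
  rw [h1, h2, eval_mul, h3, h3, hermiteFun, hermiteFun]
  ring

lemma memLp_hermiteFun (s : ℝ) (n : ℕ) : MemLp (hermiteFun s n) 2 := by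
  rcases eq_or_ne s 0 with rfl | hs
  · have : hermiteFun 0 n = 0 := by
      funext x
      simp [hermiteFun]
    rw [this]
    exact MemLp.zero
  · have hc : Continuous (hermiteFun s n) := by
      unfold hermiteFun
      have : Continuous fun x : ℝ => aeval (x / s) (hermite n) :=
        (Polynomial.continuous_aeval (hermite n)).comp (continuous_id.div_const s)
      fun_prop
    rw [memLp_two_iff_integrable_sq hc.aestronglyMeasurable]
    refine Integrable.congr (f := fun x => hermiteFun s n x * hermiteFun s n x) ?_
      (Eventually.of_forall fun x => (pow_two _).symm)
    simp only [hermiteFun_mul hs]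
    exact ((integrable_poly_gauss _).comp_div hs).const_mul _

lemma integral_hermiteFun {s : ℝ} (hs : 0 < s) (n k : ℕ) (hkn : k ≤ n) :
    ∫ x, hermiteFun s n x * hermiteFun s k x = if n = k then 1 else 0 := by
  simp only [hermiteFun_mul hs.ne']
  rw [integral_const_mul, Measure.integral_comp_div
    (fun y => (((hermite n).map (Int.castRingHom ℝ)) *
      ((hermite k).map (Int.castRingHom ℝ))).eval y * Real.exp (-(y ^ 2 / 2))),
    integral_hermite_hermite n k hkn]
  split_ifs with h
  · subst h
    have h1 : √(2 * Real.pi * s ^ 2) = √(2 * Real.pi) * s := by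
      rw [Real.sqrt_mul (by positivity), Real.sqrt_sq hs.le]
    have h2 : √(n.factorial : ℝ) * √(n.factorial : ℝ) = n.factorial :=
      Real.mul_self_sqrt (by positivity)
    have h3 : (n.factorial : ℝ) ≠ 0 := by positivity
    rw [h1, abs_of_pos hs, smul_eq_mul, ← mul_inv, h2]
    have : √(2 * Real.pi) ≠ 0 := by positivity
    field_simp
  · simp

/-- The Hermite function of length scale `s` as an element of `L²(ℝ, dx)`. -/
def hermiteKet (s : ℝ) (n : ℕ) : L2R :=
  (memLp_hermiteFun s n).ofReal.toLp (fun x => ((hermiteFun s n x : ℝ) : ℂ))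

lemma inner_hermiteKet (s : ℝ) (n k : ℕ) :
    ⟪hermiteKet s n, hermiteKet s k⟫_ℂ = ((∫ x, hermiteFun s n x * hermiteFun s k x : ℝ) : ℂ) := by
  rw [L2.inner_def, ← integral_complex_ofReal]
  refine integral_congr_ae ?_
  have h1 := (memLp_hermiteFun s n).ofReal (K := ℂ) |>.coeFn_toLp
  have h2 := (memLp_hermiteFun s k).ofReal (K := ℂ) |>.coeFn_toLp
  filter_upwards [h1, h2] with x hx1 hx2
  simp only [hermiteKet]
  erw [hx1, hx2]
  simp [mul_comm]

lemma orthonormal_hermiteKet {s : ℝ} (hs : 0 < s) : Orthonormal ℂ (hermiteKet s) := by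
  rw [orthonormal_iff_ite]
  intro n k
  rw [inner_hermiteKet]
  rcases le_total k n with h | h
  · rw [integral_hermiteFun hs n k h]
    split_ifs <;> simp
  · simp only [mul_comm (hermiteFun s n _)]
    rw [integral_hermiteFun hs k n h]
    simp only [eq_comm]
    split_ifs <;> simp

/-! ### The quantum harmonic oscillator with mass `m` and frequency `ω` (`ℏ = 1`) -/

/-- The length scale `1 / √(2 m ω)` of the ground state. -/
def groundScale (m ω : ℝ) : ℝ := 1 / √(2 * m * ω)

lemma groundScale_pos {m ω : ℝ} (hm : 0 < m) (hω : 0 < ω) : 0 < groundScale m ω := by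
  unfold groundScale
  positivity

/-- The energy eigenvalue `E_n = ω (n + 1/2)`. -/
def energy (ω : ℝ) (n : ℕ) : ℝ := ω * (n + 1 / 2)

/-- The domain `D(H)` of the self-adjoint Hamiltonian
`H = P² / (2 m) + m ω² Q² / 2 = ∑ n, E_n |φ_n⟩⟨φ_n|`:
all `ψ ∈ L²(ℝ)` with `∑ n, E_n² |⟨φ_n, ψ⟩|² < ∞`. -/
def hamiltonianDomain (m ω : ℝ) : Set L2R :=
  {ψ | Summable fun n => energy ω n ^ 2 * ‖⟪hermiteKet (groundScale m ω) n, ψ⟫_ℂ‖ ^ 2}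

lemma norm_phase_le (ω t : ℝ) (n : ℕ) :
    ‖Complex.exp (((-(energy ω n * t) : ℝ) : ℂ) * Complex.I)‖ ≤ 1 :=
  (Complex.norm_exp_ofReal_mul_I _).le

/-- The unitary time evolution `exp(-i H t) ψ = ∑ n, exp(-i E_n t) ⟨φ_n, ψ⟩ φ_n`. -/
def evolution {m ω : ℝ} (hm : 0 < m) (hω : 0 < ω) (t : ℝ) : L2R →L[ℂ] L2R :=
  diagonal (orthonormal_hermiteKet (groundScale_pos hm hω))
    (fun n => Complex.exp (((-(energy ω n * t) : ℝ) : ℂ) * Complex.I)) (norm_phase_le ω t)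

/-- The dynamical group on operators, `τ_t V = exp(-i H t) V exp(i H t)`. -/
def dynamics {m ω : ℝ} (hm : 0 < m) (hω : 0 < ω) (t : ℝ) (V : L2R →L[ℂ] L2R) : L2R →L[ℂ] L2R :=
  evolution hm hω t ∘L V ∘L evolution hm hω (-t)

/-! ### The classical representation induced by coherent states -/

/-- The coherent state `u^σ_{qp}(x) = exp(i p x) u^σ(x - q)`, where
`u^σ(x) = (2 π σ²)^{-1/4} exp(-x² / (4 σ²))`. -/
def coherentFun (σ q p x : ℝ) : ℂ :=
  Complex.exp (((p * x : ℝ) : ℂ) * Complex.I) *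
    ((((2 * Real.pi * σ ^ 2) ^ (1 / 4 : ℝ))⁻¹ * Real.exp (-((x - q) ^ 2 / (4 * σ ^ 2))) : ℝ) : ℂ)

lemma memLp_coherentFun (σ q p : ℝ) : MemLp (coherentFun σ q p) 2 := by
  have h1 : MemLp (fun x => hermiteFun σ 0 (x - q)) 2 :=
    (memLp_hermiteFun σ 0).comp_measurePreserving (measurePreserving_sub_right volume q)
  have h2 : Continuous (coherentFun σ q p) := by
    unfold coherentFun
    fun_prop
  refine h1.congr_norm h2.aestronglyMeasurable (Eventually.of_forall fun x => ?_)
  simp only [coherentFun, norm_mul, Complex.norm_exp_ofReal_mul_I, Complex.norm_real, hermiteFun]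
  simp

/-- The coherent state `u^σ_{qp}` as an element of `L²(ℝ, dx)`. -/
def coherentKet (σ q p : ℝ) : L2R :=
  (memLp_coherentFun σ q p).toLp (coherentFun σ q p)

/-- The phase-space density `T̂V`, i.e. `(T̂V)(q, p) = (2 π)⁻¹ tr (V a_{qp})` with
`a_{qp} = |u^σ_{qp}⟩⟨u^σ_{qp}|` (a real number for self-adjoint `V`). -/
def phaseDensity (σ : ℝ) (V : L2R →L[ℂ] L2R) (x : ℝ × ℝ) : ℝ :=
  (2 * Real.pi)⁻¹ *
    (trace (V ∘L rankOne ℂ (coherentKet σ x.1 x.2) (coherentKet σ x.1 x.2))).re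

/-- The graph of the operator `L̂ = T̂ Z T̂⁻¹` on phase-space densities, with domain
`D(L̂) = T̂ D(Z)`: `ρ = T̂V` and `g = T̂(Z V)` for some `V ∈ D(Z)`, where `Z` is the infinitesimal
generator of the dynamical group of the oscillator. -/
def LiouvilleGraph {m ω : ℝ} (hm : 0 < m) (hω : 0 < ω) (σ : ℝ) (ρ g : ℝ × ℝ → ℝ) : Prop :=
  ∃ V V' : L2R →L[ℂ] L2R, GeneratorGraph (dynamics hm hω) V V' ∧
    phaseDensity σ V = ρ ∧ phaseDensity σ V' = g

/-! ### Classical mechanics on the phase space `ℝ × ℝ` -/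

/-- `∂f/∂q`. -/
def dq (f : ℝ × ℝ → ℝ) (x : ℝ × ℝ) : ℝ := deriv (fun q => f (q, x.2)) x.1

/-- `∂f/∂p`. -/
def dp (f : ℝ × ℝ → ℝ) (x : ℝ × ℝ) : ℝ := deriv (fun p => f (x.1, p)) x.2

/-- The Poisson bracket `{f, g} = ∂f/∂p ∂g/∂q - ∂f/∂q ∂g/∂p`, in the sign convention in which the
Liouville equation reads `∂ρ/∂t = -{H, ρ}`. -/
def poisson (f g : ℝ × ℝ → ℝ) (x : ℝ × ℝ) : ℝ := dp f x * dq g x - dq f x * dp g x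

/-- The classical Hamiltonian `H(q, p) = p² / (2 m) + m ω² q² / 2`. -/
def classicalHamiltonian (m ω : ℝ) (x : ℝ × ℝ) : ℝ :=
  x.2 ^ 2 / (2 * m) + m * ω ^ 2 / 2 * x.1 ^ 2

/-- `Φ` is the Hamiltonian flow of `H`: `t ↦ Φ_t x` is the solution of Hamilton's equations
`q' = ∂H/∂p`, `p' = -∂H/∂q` that starts at `x`. -/
def IsHamiltonianFlow (H : ℝ × ℝ → ℝ) (Φ : ℝ → ℝ × ℝ ≃ ℝ × ℝ) : Prop :=
  ∀ x, Φ 0 x = x ∧ ∀ t, HasDerivAt (fun s => Φ s x) (dp H (Φ t x), -dq H (Φ t x)) t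

/-- The oscillator has a Hamiltonian flow (uniform rotation of phase space). -/
lemma exists_isHamiltonianFlow {m ω : ℝ} (hm : 0 < m) (hω : 0 < ω) :
    ∃ Φ : ℝ → ℝ × ℝ ≃ ℝ × ℝ, IsHamiltonianFlow (classicalHamiltonian m ω) Φ := by
  have hq : ∀ x, dq (classicalHamiltonian m ω) x = m * ω ^ 2 * x.1 := fun x => by
    have h := (((hasDerivAt_id x.1).pow 2).const_mul (m * ω ^ 2 / 2)).const_add (x.2 ^ 2 / (2 * m))
    refine Eq.trans h.deriv ?_
    simp
    ring
  have hp : ∀ x, dp (classicalHamiltonian m ω) x = x.2 / m := fun x => by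
    have h := (((hasDerivAt_id x.2).pow 2).div_const (2 * m)).add_const (m * ω ^ 2 / 2 * x.1 ^ 2)
    refine Eq.trans h.deriv ?_
    simp
    field_simp
  have hinv : ∀ (t : ℝ) (x : ℝ × ℝ), (fun y : ℝ × ℝ =>
      (y.1 * Real.cos (ω * t) - y.2 / (m * ω) * Real.sin (ω * t),
        y.2 * Real.cos (ω * t) + m * ω * y.1 * Real.sin (ω * t)))
      (x.1 * Real.cos (ω * t) + x.2 / (m * ω) * Real.sin (ω * t),
        x.2 * Real.cos (ω * t) - m * ω * x.1 * Real.sin (ω * t)) = x := fun t x => by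
    have h := Real.sin_sq_add_cos_sq (ω * t)
    ext
    · simp only
      field_simp
      linear_combination (m * ω * x.1) * h
    · simp only
      field_simp
      linear_combination x.2 * h
  refine ⟨fun t =>
    { toFun := fun x => (x.1 * Real.cos (ω * t) + x.2 / (m * ω) * Real.sin (ω * t),
        x.2 * Real.cos (ω * t) - m * ω * x.1 * Real.sin (ω * t))
      invFun := fun x => (x.1 * Real.cos (ω * t) - x.2 / (m * ω) * Real.sin (ω * t),
        x.2 * Real.cos (ω * t) + m * ω * x.1 * Real.sin (ω * t))
      left_inv := hinv t
      right_inv := fun x => by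
        have h := hinv (-t) x
        simp only [mul_neg, Real.cos_neg, Real.sin_neg] at h
        simpa [sub_eq_add_neg] using h }, fun x => ⟨by simp, fun t => ?_⟩⟩
  have hl : HasDerivAt (fun s : ℝ => ω * s) ω t := by simpa using (hasDerivAt_id t).const_mul ω
  have hs := hl.sin
  have hc := hl.cos
  rw [hp, hq]
  refine HasDerivAt.prodMk ?_ ?_
  · refine ((hc.const_mul x.1).add (hs.const_mul (x.2 / (m * ω)))).congr_deriv ?_
    simp only [Equiv.coe_fn_mk]
    field_simp
    ring
  · refine ((hc.const_mul x.2).sub (hs.const_mul (m * ω * x.1))).congr_deriv ?_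
    simp only [Equiv.coe_fn_mk]
    field_simp
    ring

/-- The right-hand side `-{H, ρ} + (m ω² σ² - 1/(4 m σ²)) ∂²ρ/∂q∂p` of the equation of motion. -/
def correctedLiouville (m ω σ : ℝ) (ρ : ℝ × ℝ → ℝ) (x : ℝ × ℝ) : ℝ :=
  -poisson (classicalHamiltonian m ω) ρ x +
    (m * ω ^ 2 * σ ^ 2 - 1 / (4 * m * σ ^ 2)) * dq (dp ρ) x

end PhaseSpace

end

open PhaseSpace

noncomputable section

namespace PhaseSpace

/-! ### Trace and trace norm of finite-rank operators -/

section FiniteRank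

variable {E : Type*} [NormedAddCommGroup E] [InnerProductSpace ℂ E] [CompleteSpace E]

/-! The coherent state at `(q, p)` is a scalar multiple of `coherentVec σ t`, an entire `L²`-valued
function of the amplitude `t = q/(2σ) + iσp` (`coherentKet_eq`). Hence `T̂V` is a Gaussian weight
times `Re ⟨A(t), V A(t)⟩` with `A` entire. This gives smoothness for every bounded `V`. It also
gives injectivity, since a form holomorphic in one amplitude and antiholomorphic in the other is
determined by its diagonal (`phaseDensity_injective`).

For (a), `H` acts on `A(t)` as a second-order differential operator in `t`. This is checked on
Hermite coefficients by comparing generating functions (`energy_mul_inner_coherentVec`). Since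
`∂/∂q` and `∂/∂p` act on `A` through `d/dt`, the differential expression applied to `T̂V` is the
weighted value of `-2 Im ⟨A, V H A⟩` (`correctedLiouville_phaseDensity`); the mixed second
derivative accounts for the `A''` term of `H A`. When `V` is a mixture of vectors in `D(H)`, `H` can
be moved onto these vectors, and the result is the density of `-i[H, V]`
(`correctedLiouville_mixture`).

That `-i[H, V]` is the generator applied to `V` follows from Schrödinger's equation: difference
quotients converge in operator norm and have uniformly bounded rank, hence converge in trace norm
(`generatorGraph_mixture`). For the derivative in `L¹`, coherent amplitudes are square integrable
over phase space, so `(x, y) ↦ T̂|x⟩⟨y|` is bounded and real bilinear into `L¹` and can be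
differentiated along Schrödinger curves (`hasDerivAt_toL1_phaseDensity`).

For (b), if `σ` is the ground-state scale, the evolution multiplies the amplitude by `exp(-iωt)` up
to a phase (`evolution_coherentVec`). In amplitude coordinates the classical flow is the same
rotation, so densities are transported along it, and the chain rule gives Liouville's equation. -/

lemma trace_comp_rankOne (V : E →L[ℂ] E) (u : E) :
    trace (V ∘L rankOne ℂ u u) = ⟪u, V u⟫_ℂ := by
  rw [trace, ← (basis E).tsum_inner_mul_inner u (V u)]
  refine tsum_congr fun i => ?_
  simp

lemma norm_abs_apply (A : E →L[ℂ] E) (x : E) : ‖CFC.abs A x‖ = ‖A x‖ := by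
  have hsa : IsSelfAdjoint (CFC.abs A) := (CFC.abs_nonneg A).isSelfAdjoint
  have h1 : ⟪CFC.abs A x, CFC.abs A x⟫_ℂ = ⟪A x, A x⟫_ℂ := by
    rw [← ContinuousLinearMap.adjoint_inner_right, ← ContinuousLinearMap.star_eq_adjoint,
      hsa.star_eq, ← mul_apply_eq_comp, CFC.abs_mul_abs,
      mul_apply_eq_comp, ContinuousLinearMap.star_eq_adjoint,
      ContinuousLinearMap.adjoint_inner_right]
  rw [inner_self_eq_norm_sq_to_K, inner_self_eq_norm_sq_to_K] at h1
  have h2 : ‖CFC.abs A x‖ ^ 2 = ‖A x‖ ^ 2 := by exact_mod_cast h1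
  exact (sq_eq_sq₀ (norm_nonneg _) (norm_nonneg _)).1 h2

/-- By `norm_abs_apply`, `|A|` vanishes wherever `A` does; being self-adjoint, it lets both
arguments be replaced by the projection of `x` to `S`. -/
lemma re_inner_abs_le {A : E →L[ℂ] E} {S : Submodule ℂ E} [S.HasOrthogonalProjection]
    (hA : ∀ z ∈ Sᗮ, A z = 0) (x : E) :
    (⟪x, CFC.abs A x⟫_ℂ).re ≤ ‖A‖ * ‖S.orthogonalProjectionOnto x‖ ^ 2 := by
  have hsa : IsSelfAdjoint (CFC.abs A) := (CFC.abs_nonneg A).isSelfAdjoint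
  set y : E := (S.orthogonalProjectionOnto x : E) with hy
  have hz : CFC.abs A (x - y) = 0 := by
    have h0 : A (x - y) = 0 := hA _ (by
      simp [hy])
    rw [← norm_eq_zero, norm_abs_apply, h0, norm_zero]
  have hxy : CFC.abs A x = CFC.abs A y := by rwa [map_sub, sub_eq_zero] at hz
  have h1 : ⟪x, CFC.abs A x⟫_ℂ = ⟪CFC.abs A y, y⟫_ℂ := by
    rw [hxy, ← ContinuousLinearMap.adjoint_inner_left,
      ← ContinuousLinearMap.star_eq_adjoint, hsa.star_eq, hxy]
  rw [h1]
  calc _ ≤ ‖⟪CFC.abs A y, y⟫_ℂ‖ := Complex.re_le_norm _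
    _ ≤ ‖CFC.abs A y‖ * ‖y‖ := norm_inner_le_norm _ _
    _ ≤ ‖A‖ * ‖y‖ * ‖y‖ := by
      rw [norm_abs_apply]
      gcongr
      exact A.le_opNorm y
    _ = ‖A‖ * ‖S.orthogonalProjectionOnto x‖ ^ 2 := by
      rw [hy, Submodule.coe_norm]; ring

omit [CompleteSpace E] in
lemma hasSum_norm_inner_sq {ι : Type*} (b : HilbertBasis ι ℂ E) (x : E) :
    HasSum (fun i => ‖⟪b i, x⟫_ℂ‖ ^ 2) (‖x‖ ^ 2) := by
  have h := (b.hasSum_inner_mul_inner x x).mapL Complex.reCLM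
  have h2 : Complex.reCLM ⟪x, x⟫_ℂ = ‖x‖ ^ 2 := by
    rw [inner_self_eq_norm_sq_to_K, Complex.reCLM_apply]
    norm_cast
  rw [h2] at h
  refine h.congr_fun fun i => ?_
  rw [← inner_conj_symm, RCLike.norm_conj, Complex.mul_conj', Complex.reCLM_apply]
  norm_cast

-- The sum is the trace of the projection: expand in an orthonormal basis of `S`, exchange the sums,
-- and use Parseval.
omit [CompleteSpace E] in
lemma tsum_norm_orthogonalProjection_sq {ι : Type*} (b : HilbertBasis ι ℂ E)
    (S : Submodule ℂ E) [FiniteDimensional ℂ S] :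
    ∑' i, ENNReal.ofReal (‖S.orthogonalProjectionOnto (b i)‖ ^ 2) = Module.finrank ℂ S := by
  set e := stdOrthonormalBasis ℂ S
  have h1 : ∀ i, ENNReal.ofReal (‖S.orthogonalProjectionOnto (b i)‖ ^ 2) =
      ∑ j, ENNReal.ofReal (‖⟪b i, (e j : E)⟫_ℂ‖ ^ 2) := fun i => by
    rw [← e.sum_sq_norm_inner_right, ENNReal.ofReal_sum_of_nonneg fun _ _ => by positivity]
    refine Finset.sum_congr rfl fun j _ => ?_
    rw [norm_inner_symm, ← Submodule.inner_orthogonalProjectionOnto_eq_of_mem_right]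
  have h2 : ∀ j, ∑' i, ENNReal.ofReal (‖⟪b i, (e j : E)⟫_ℂ‖ ^ 2) = 1 := fun j => by
    rw [← ENNReal.ofReal_tsum_of_nonneg (fun _ => by positivity)
      (hasSum_norm_inner_sq b _).summable, (hasSum_norm_inner_sq b _).tsum_eq,
      Submodule.norm_coe, e.norm_eq_one, one_pow, ENNReal.ofReal_one]
  simp_rw [h1]
  rw [Summable.tsum_finsetSum fun _ _ => ENNReal.summable]
  rw [Finset.sum_congr rfl fun j _ => h2 j]
  simp

/-- The trace norm of an operator of finite rank is controlled by its operator norm. -/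
lemma traceNorm_le_of_eq_zero_on_orthogonal {A : E →L[ℂ] E} {S : Submodule ℂ E}
    [FiniteDimensional ℂ S] (hA : ∀ z ∈ Sᗮ, A z = 0) :
    traceNorm A ≤ ENNReal.ofReal ‖A‖ * Module.finrank ℂ S := by
  rw [← tsum_norm_orthogonalProjection_sq (basis E) S, ← ENNReal.tsum_mul_left, traceNorm]
  refine ENNReal.tsum_le_tsum fun i => ?_
  rw [← ENNReal.ofReal_mul (norm_nonneg _)]
  exact ENNReal.ofReal_le_ofReal (re_inner_abs_le hA _)

/-- Suited to difference quotients: the vectors `y` may vary with time while their number stays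
fixed, so operator-norm convergence upgrades to trace-norm convergence. -/
lemma traceNorm_le_of_forall_inner {ι : Type*} [Fintype ι] {A : E →L[ℂ] E} (y : ι → E)
    (hA : ∀ z, (∀ i, ⟪y i, z⟫_ℂ = 0) → A z = 0) :
    traceNorm A ≤ ENNReal.ofReal ‖A‖ * Fintype.card ι := by
  have : FiniteDimensional ℂ (Submodule.span ℂ (Set.range y)) :=
    FiniteDimensional.span_of_finite ℂ (Set.finite_range y)
  refine (traceNorm_le_of_eq_zero_on_orthogonal (S := Submodule.span ℂ (Set.range y))
    fun z hz => hA z fun i => ?_).trans ?_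
  · exact (Submodule.mem_orthogonal _ _).1 hz _ (Submodule.subset_span ⟨i, rfl⟩)
  · gcongr
    exact_mod_cast finrank_range_le_card y

end FiniteRank

/-! ### Coherent vectors as power series in the Hermite functions -/

/-- Each term is, in absolute value, the product of `(2|r|)^n / √n!` and `2^{-n}`, both square
summable. -/
lemma summable_pow_div_sqrt_factorial (r : ℝ) :
    Summable fun n : ℕ => r ^ n / √(n.factorial : ℝ) := by
  have h1 : Summable fun n : ℕ => (4 * r ^ 2) ^ n / (n.factorial : ℝ) + (1 / 4) ^ n :=
    (Real.summable_pow_div_factorial _).add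
      (summable_geometric_of_lt_one (by norm_num) (by norm_num))
  refine Summable.of_norm_bounded h1 fun n => ?_
  have hf : (0 : ℝ) < n.factorial := by positivity
  have h2 : (4 * r ^ 2) ^ n / (n.factorial : ℝ) = ((2 * |r|) ^ n / √(n.factorial : ℝ)) ^ 2 := by
    rw [div_pow, Real.sq_sqrt hf.le, ← pow_mul, mul_comm n 2, pow_mul, mul_pow 2 |r|, sq_abs]
    norm_num
  have h3 : ((1 : ℝ) / 4) ^ n = ((1 / 2) ^ n) ^ 2 := by
    rw [← pow_mul, mul_comm n 2, pow_mul]; norm_num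
  have h4 : ‖r ^ n / √(n.factorial : ℝ)‖ =
      ((2 * |r|) ^ n / √(n.factorial : ℝ)) * (1 / 2) ^ n := by
    rw [norm_div, norm_pow, Real.norm_eq_abs, Real.norm_of_nonneg (Real.sqrt_nonneg _), mul_pow,
      div_pow, one_pow]
    field_simp
  rw [h2, h3, h4]
  nlinarith [sq_nonneg ((2 * |r|) ^ n / √(n.factorial : ℝ) - (1 / 2) ^ n),
    sq_nonneg ((2 * |r|) ^ n / √(n.factorial : ℝ)), sq_nonneg (((1 : ℝ) / 2) ^ n)]

/-- The coherent vector `∑ n, t ^ n / √n! φ_n` of complex amplitude `t` (not normalized), with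
`φ_n` the Hermite functions of length scale `s`. -/
def coherentVec (s : ℝ) (t : ℂ) : L2R :=
  ∑' n : ℕ, (t ^ n / ((√(n.factorial : ℝ) : ℝ) : ℂ)) • hermiteKet s n

section

variable {s : ℝ} (hs : 0 < s)
include hs

lemma norm_hermiteKet (n : ℕ) : ‖hermiteKet s n‖ = 1 := (orthonormal_hermiteKet hs).1 n

lemma norm_coherentVec_term (t : ℂ) (n : ℕ) :
    ‖(t ^ n / ((√(n.factorial : ℝ) : ℝ) : ℂ)) • hermiteKet s n‖ =
      ‖t‖ ^ n / √(n.factorial : ℝ) := by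
  rw [norm_smul, norm_hermiteKet hs, mul_one, norm_div, norm_pow, Complex.norm_real,
    Real.norm_of_nonneg (Real.sqrt_nonneg _)]

lemma hasSum_coherentVec (t : ℂ) :
    HasSum (fun n : ℕ => (t ^ n / ((√(n.factorial : ℝ) : ℝ) : ℂ)) • hermiteKet s n)
      (coherentVec s t) := by
  refine Summable.hasSum (Summable.of_norm ?_)
  simp only [norm_coherentVec_term hs]
  exact summable_pow_div_sqrt_factorial _

/-- The series of polynomials converges uniformly on balls. All later smoothness in `(q, p)` comes
from this holomorphy. -/
lemma differentiable_coherentVec : Differentiable ℂ (coherentVec s) := by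
  intro t
  have h := Complex.differentiableOn_tsum_of_summable_norm
    (F := fun (n : ℕ) (t : ℂ) => (t ^ n / ((√(n.factorial : ℝ) : ℝ) : ℂ)) • hermiteKet s n)
    (summable_pow_div_sqrt_factorial (‖t‖ + 1)) (U := Metric.ball 0 (‖t‖ + 1))
    (fun n => by fun_prop) Metric.isOpen_ball (fun n w hw => by
      rw [norm_coherentVec_term hs]
      have : ‖w‖ ≤ ‖t‖ + 1 := (mem_ball_zero_iff.1 hw).le
      gcongr)
  exact (h t (by simp)).differentiableAt (Metric.isOpen_ball.mem_nhds (by simp))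

lemma inner_hermiteKet_coherentVec (n : ℕ) (t : ℂ) :
    ⟪hermiteKet s n, coherentVec s t⟫_ℂ = t ^ n / ((√(n.factorial : ℝ) : ℝ) : ℂ) := by
  have h := (hasSum_coherentVec hs t).mapL (innerSL ℂ (hermiteKet s n))
  rw [innerSL_apply_apply] at h
  refine h.unique ?_
  refine (hasSum_ite_eq n (t ^ n / ((√(n.factorial : ℝ) : ℝ) : ℂ))).congr_fun fun k => ?_
  rw [innerSL_apply_apply, inner_smul_right, orthonormal_iff_ite.1 (orthonormal_hermiteKet hs) n k]
  by_cases hk : k = n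
  · simp [hk]
  · simp [hk, Ne.symm hk]

/-- Conjugating the amplitude cancels the antilinearity of the first slot, so the inner product is a
power series in `r`: the generating function of the Hermite coefficients of `f`. -/
lemma hasSum_inner_coherentVec_conj (f : L2R) (r : ℂ) :
    HasSum (fun n : ℕ => r ^ n / ((√(n.factorial : ℝ) : ℝ) : ℂ) * ⟪hermiteKet s n, f⟫_ℂ)
      ⟪coherentVec s (starRingEnd ℂ r), f⟫_ℂ := by
  have h := ((hasSum_coherentVec hs (starRingEnd ℂ r)).mapL (innerSL ℂ f)).mapL
    (Complex.conjCLE : ℂ →L[ℝ] ℂ)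
  convert h using 1
  · funext n
    simp [inner_conj_symm]
  · simp [inner_conj_symm]

end

/-- The generating function of the Hermite polynomials. -/
lemma hasSum_hermite (x : ℝ) (t : ℂ) :
    HasSum (fun n : ℕ => t ^ n / (n.factorial : ℂ) * ((aeval x (hermite n) : ℝ) : ℂ))
      (Complex.exp (t * x - t ^ 2 / 2)) := by
  -- Differentiating in `z` raises the index, by `He_{n+1} = X He_n - He_n'`; so `He_n(x)` is the
  -- `n`-th derivative of the generating function at zero.
  have hd : ∀ (n : ℕ) (z : ℂ), HasDerivAt
      (fun z : ℂ => aeval ((x : ℂ) - z) (hermite n) * Complex.exp (z * x - z ^ 2 / 2))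
      (aeval ((x : ℂ) - z) (hermite (n + 1)) * Complex.exp (z * x - z ^ 2 / 2)) z := fun n z => by
    have h1 : HasDerivAt (fun z : ℂ => (x : ℂ) - z) (-1) z := (hasDerivAt_id z).const_sub _
    have h2 := ((hermite n).hasDerivAt_aeval ((x : ℂ) - z)).comp z h1
    have h3 : HasDerivAt (fun z : ℂ => z * x - z ^ 2 / 2) (x - z) z := by
      refine (((hasDerivAt_id z).mul_const (x : ℂ)).sub
        (((hasDerivAt_id z).pow 2).div_const 2)).congr_deriv ?_
      simp
    refine (h2.mul h3.cexp).congr_deriv ?_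
    rw [hermite_succ, map_sub, map_mul, aeval_X]
    simp only [Function.comp]
    ring
  have hi : ∀ n : ℕ, iteratedDeriv n (fun z : ℂ => Complex.exp (z * x - z ^ 2 / 2)) =
      fun z => aeval ((x : ℂ) - z) (hermite n) * Complex.exp (z * x - z ^ 2 / 2) := fun n => by
    induction n with
    | zero => funext z; simp
    | succ n ih =>
      funext z
      rw [iteratedDeriv_succ, ih, (hd n z).deriv]
  have h := Complex.hasSum_taylorSeries_of_entire
    (f := fun z : ℂ => Complex.exp (z * x - z ^ 2 / 2)) (by fun_prop) 0 t
  refine h.congr_fun fun n => ?_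
  rw [hi n]
  beta_reduce
  have : aeval ((x : ℂ) - 0) (hermite n) = ((aeval x (hermite n) : ℝ) : ℂ) := by
    rw [sub_zero]
    exact aeval_algebraMap_apply ℂ x (hermite n)
  rw [this]
  simp
  ring

/-- If a series converges in `L²` and pointwise almost everywhere, the two sums agree. -/
lemma ae_eq_of_hasSum {f : ℕ → L2R} {g : L2R} (hfg : HasSum f g) {F : ℕ → ℝ → ℂ} {G : ℝ → ℂ}
    (hF : ∀ n, f n =ᵐ[volume] F n) (hFG : ∀ x, HasSum (fun n => F n x) (G x)) :
    g =ᵐ[volume] G := by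
  -- Convergence in `L²` implies convergence in measure, hence almost everywhere along a
  -- subsequence.
  obtain ⟨ns, hns, h⟩ :=
    (tendstoInMeasure_of_tendsto_Lp hfg.tendsto_sum_nat).exists_seq_tendsto_ae
  have hsum : ∀ N : ℕ, ⇑(∑ n ∈ Finset.range N, f n) =ᵐ[volume]
      fun x => ∑ n ∈ Finset.range N, F n x := fun N => by
    induction N with
    | zero => simpa using! Lp.coeFn_zero ℂ 2 volume
    | succ N ih =>
      rw [Finset.sum_range_succ]
      filter_upwards [Lp.coeFn_add (∑ n ∈ Finset.range N, f n) (f N), ih, hF N] with x h1 h2 h3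
      rw [h1, Pi.add_apply, h2, h3, Finset.sum_range_succ]
  filter_upwards [h, ae_all_iff.2 hsum] with x h1 h2
  refine tendsto_nhds_unique h1 ?_
  simp only [h2]
  exact (hFG x).tendsto_sum_nat.comp hns.tendsto_atTop

/-- The wave function of the coherent vector of amplitude `t`. -/
def coherentVecFun (s : ℝ) (t : ℂ) (x : ℝ) : ℂ :=
  (((2 * Real.pi * s ^ 2) ^ (1 / 4 : ℝ))⁻¹ : ℝ) *
    Complex.exp (-(x ^ 2 / (4 * s ^ 2)) + t * (x / s) - t ^ 2 / 2)

lemma coherentVec_ae_eq {s : ℝ} (hs : 0 < s) (t : ℂ) :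
    coherentVec s t =ᵐ[volume] coherentVecFun s t := by
  refine ae_eq_of_hasSum (hasSum_coherentVec hs t)
    (F := fun n x => (t ^ n / ((√(n.factorial : ℝ) : ℝ) : ℂ)) * (hermiteFun s n x : ℂ))
    (fun n => ?_) fun x => ?_
  · filter_upwards [Lp.coeFn_smul (t ^ n / ((√(n.factorial : ℝ) : ℝ) : ℂ)) (hermiteKet s n),
      ((memLp_hermiteFun s n).ofReal (K := ℂ)).coeFn_toLp] with x h1 h2
    rw [h1, Pi.smul_apply, smul_eq_mul]
    congr 1
  · have h := (hasSum_hermite (x / s) t).mul_left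
      (((((2 * Real.pi * s ^ 2) ^ (1 / 4 : ℝ))⁻¹ : ℝ) : ℂ) *
        Complex.exp (-(x ^ 2 / (4 * s ^ 2))))
    have hG : coherentVecFun s t x = ((((2 * Real.pi * s ^ 2) ^ (1 / 4 : ℝ))⁻¹ : ℝ) : ℂ) *
        Complex.exp (-(x ^ 2 / (4 * s ^ 2))) *
          Complex.exp (t * ((x / s : ℝ) : ℂ) - t ^ 2 / 2) := by
      rw [coherentVecFun, mul_assoc (Complex.ofReal _), ← Complex.exp_add]
      congr 2
      push_cast
      ring
    rw [hG]
    refine h.congr_fun fun n => ?_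
    have hf : ((√(n.factorial : ℝ) : ℝ) : ℂ) * ((√(n.factorial : ℝ) : ℝ) : ℂ) =
        (n.factorial : ℂ) := by
      rw [← Complex.ofReal_mul, Real.mul_self_sqrt (by positivity)]
      norm_cast
    have hf0 : ((√(n.factorial : ℝ) : ℝ) : ℂ) ≠ 0 := by
      rw [Complex.ofReal_ne_zero]; positivity
    rw [hermiteFun, ← hf]
    push_cast
    field_simp

lemma inner_eq_integral_of_ae_eq {f g : L2R} {F G : ℝ → ℂ} (hf : f =ᵐ[volume] F)
    (hg : g =ᵐ[volume] G) : ⟪f, g⟫_ℂ = ∫ x, starRingEnd ℂ (F x) * G x := by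
  rw [L2.inner_def]
  refine integral_congr_ae ?_
  filter_upwards [hf, hg] with x h1 h2
  rw [h1, h2, RCLike.inner_apply']

/-- Expanding `ipx - (x - q)²/(4σ²)`, the coefficient of `x/σ` is the amplitude; the terms free of
`x` form the scalar. -/
lemma coherentKet_eq {σ : ℝ} (hσ : 0 < σ) (q p : ℝ) :
    coherentKet σ q p =
      Complex.exp (-(q ^ 2 / (8 * σ ^ 2)) - σ ^ 2 * p ^ 2 / 2 + q * p / 2 * Complex.I) •
        coherentVec σ (q / (2 * σ) + σ * p * Complex.I) := by
  refine Lp.ext ?_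
  filter_upwards [(memLp_coherentFun σ q p).coeFn_toLp, Lp.coeFn_smul
    (Complex.exp (-(q ^ 2 / (8 * σ ^ 2)) - σ ^ 2 * p ^ 2 / 2 + q * p / 2 * Complex.I))
    (coherentVec σ (q / (2 * σ) + σ * p * Complex.I)),
    coherentVec_ae_eq hσ (q / (2 * σ) + σ * p * Complex.I)] with x h1 h2 h3
  rw [coherentKet, h1, h2, Pi.smul_apply, h3, coherentFun, coherentVecFun, smul_eq_mul]
  push_cast
  rw [mul_left_comm, mul_left_comm (Complex.exp _), ← Complex.exp_add, ← Complex.exp_add]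
  congr 2
  have hσ' : (σ : ℂ) ≠ 0 := by exact_mod_cast hσ.ne'
  field_simp
  linear_combination (128 * σ ^ 4 * p ^ 2 : ℂ) * Complex.I_sq

/-! ### Completeness of the Hermite functions -/

/-- An integrable function on the line with vanishing Fourier transform vanishes. -/
lemma ae_eq_zero_of_integral_mul_exp_eq_zero {F : ℝ → ℂ} (hF : Integrable F)
    (h : ∀ τ : ℝ, ∫ x : ℝ, F x * Complex.exp (((τ * x : ℝ) : ℂ) * Complex.I) = 0) :
    ∀ᵐ x, F x = 0 := by
  refine ae_eq_zero_of_integral_contDiff_smul_eq_zero hF.locallyIntegrable fun g hg hc => ?_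
  have hc' : HasCompactSupport (Complex.ofRealCLM ∘ g) := hc.comp_left rfl
  have hg' : ContDiff ℝ (⊤ : ℕ∞) (Complex.ofRealCLM ∘ g) := by fun_prop
  -- A test function is the Fourier transform of a Schwartz function `k`, and moving the transform
  -- onto `F` gives zero.
  set G := hc'.toSchwartzMap hg' with hG
  set k := FourierTransformInv.fourierInv G with hk
  have hkG : FourierTransform.fourier k = G := FourierTransform.fourier_fourierInv_eq G
  have hFF : ∀ ξ : ℝ, VectorFourier.fourierIntegral Real.fourierChar volume
      (innerₗ ℝ).flip F ξ = 0 := fun ξ => by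
    rw [VectorFourier.fourierIntegral, ← h (-(2 * Real.pi * ξ))]
    congr 1
    funext x
    rw [Circle.smul_def, Real.fourierChar_apply, smul_eq_mul, mul_comm]
    congr 3
    simp
    ring
  have hflip := VectorFourier.integral_fourierIntegral_smul_eq_flip (L := innerₗ ℝ)
    (f := k) (g := F) Real.continuous_fourierChar (by fun_prop) (k.integrable (μ := volume)) hF
  simp only [hFF, smul_zero, integral_zero] at hflip
  rw [← hflip]
  congr 1
  funext x
  have h1 : VectorFourier.fourierIntegral Real.fourierChar volume (innerₗ ℝ) k x = (g x : ℂ) := by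
    change FourierTransform.fourier (k : ℝ → ℂ) x = _
    rw [← SchwartzMap.fourier_coe, hkG]
    rfl
  rw [h1]
  simp

section

variable {s : ℝ} (hs : 0 < s)
include hs

/-- Imaginary amplitudes `isτ` suffice: there the coherent vector is a multiple of a Gaussian times
`exp(iτx)`, so the Fourier transform of `conj f` times a nowhere vanishing Gaussian is zero. -/
lemma eq_zero_of_forall_inner_coherentVec (f : L2R) (h : ∀ t, ⟪f, coherentVec s t⟫_ℂ = 0) :
    f = 0 := by
  set F : ℝ → ℂ := fun x => starRingEnd ℂ (f x) * coherentVecFun s 0 x with hF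
  have hFi : Integrable F := by
    refine (L2.integrable_inner f (coherentVec s 0)).congr ?_
    filter_upwards [coherentVec_ae_eq hs 0] with x hx
    rw [hx, RCLike.inner_apply']
  have h0 : ∀ᵐ x, F x = 0 := by
    refine ae_eq_zero_of_integral_mul_exp_eq_zero hFi fun τ => ?_
    have hτ := h (s * τ * Complex.I)
    rw [inner_eq_integral_of_ae_eq EventuallyEq.rfl (coherentVec_ae_eq hs _)] at hτ
    have hc : ∀ x : ℝ, starRingEnd ℂ (f x) * coherentVecFun s (s * τ * Complex.I) x =
        Complex.exp (s ^ 2 * τ ^ 2 / 2) *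
          (F x * Complex.exp (((τ * x : ℝ) : ℂ) * Complex.I)) := fun x => by
      simp only [hF, coherentVecFun]
      have he : Complex.exp (-(x ^ 2 / (4 * s ^ 2)) + s * τ * Complex.I * (x / s) -
          (s * τ * Complex.I) ^ 2 / 2) = Complex.exp (s ^ 2 * τ ^ 2 / 2) *
          Complex.exp (-(x ^ 2 / (4 * s ^ 2)) + 0 * (x / s) - 0 ^ 2 / 2) *
          Complex.exp (((τ * x : ℝ) : ℂ) * Complex.I) := by
        rw [← Complex.exp_add, ← Complex.exp_add]
        congr 1
        have hs' : (s : ℂ) ≠ 0 := by exact_mod_cast hs.ne'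
        push_cast
        field_simp
        linear_combination (-4 * s ^ 4 * τ ^ 2 : ℂ) * Complex.I_sq
      rw [he]
      ring
    simp only [hc] at hτ
    rw [integral_const_mul] at hτ
    exact (mul_eq_zero.1 hτ).resolve_left (Complex.exp_ne_zero _)
  rw [Lp.eq_zero_iff_ae_eq_zero]
  filter_upwards [h0] with x hx
  have hne : coherentVecFun s 0 x ≠ 0 := by
    unfold coherentVecFun
    refine mul_ne_zero ?_ (Complex.exp_ne_zero _)
    rw [Complex.ofReal_ne_zero]
    positivity
  simpa using (mul_eq_zero.1 hx).resolve_right hne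

lemma span_hermiteKet_orthogonal : (Submodule.span ℂ (Set.range (hermiteKet s)))ᗮ = ⊥ := by
  refine (Submodule.eq_bot_iff _).2 fun f hf => eq_zero_of_forall_inner_coherentVec hs f fun t => ?_
  have h := (hasSum_coherentVec hs t).mapL (innerSL ℂ f)
  rw [innerSL_apply_apply] at h
  refine h.unique (hasSum_zero.congr_fun fun n => ?_)
  rw [innerSL_apply_apply, inner_smul_right, inner_eq_zero_symm.1
    ((Submodule.mem_orthogonal _ _).1 hf _ (Submodule.subset_span ⟨n, rfl⟩)), mul_zero]

/-- The Hermite functions of length scale `s` as a Hilbert basis of `L²(ℝ, dx)`. -/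
def hermiteBasis : HilbertBasis ℕ ℂ L2R :=
  HilbertBasis.mkOfOrthogonalEqBot (orthonormal_hermiteKet hs) (span_hermiteKet_orthogonal hs)

lemma hermiteBasis_apply (n : ℕ) : hermiteBasis hs n = hermiteKet s n := by
  rw [hermiteBasis, HilbertBasis.coe_mkOfOrthogonalEqBot]

lemma hermiteBasis_repr (f : L2R) (n : ℕ) :
    (hermiteBasis hs).repr f n = ⟪hermiteKet s n, f⟫_ℂ := by
  rw [HilbertBasis.repr_apply_apply, hermiteBasis_apply]

lemma ext_inner_hermiteKet {f g : L2R}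
    (h : ∀ n, ⟪hermiteKet s n, f⟫_ℂ = ⟪hermiteKet s n, g⟫_ℂ) : f = g := by
  refine (hermiteBasis hs).repr.injective (lp.ext (funext fun n => ?_))
  rw [hermiteBasis_repr, hermiteBasis_repr, h]

end

/-! ### The unitary time evolution -/

lemma inner_diagonal {E : Type*} [NormedAddCommGroup E] [InnerProductSpace ℂ E] [CompleteSpace E]
    {v : ℕ → E} (hv : Orthonormal ℂ v) (c : ℕ → ℂ) (hc : ∀ n, ‖c n‖ ≤ 1) (x : E) (n : ℕ) :
    ⟪v n, diagonal hv c hc x⟫_ℂ = c n * ⟪v n, x⟫_ℂ := by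
  have h : HasSum (fun k => (c k * ⟪v k, x⟫_ℂ) • v k) (diagonal hv c hc x) :=
    (diagonal_summable hv c hc x).hasSum
  have h' := h.mapL (innerSL ℂ (v n))
  rw [innerSL_apply_apply] at h'
  refine h'.unique ((hasSum_ite_eq n (c n * ⟪v n, x⟫_ℂ)).congr_fun fun k => ?_)
  rw [innerSL_apply_apply, inner_smul_right, orthonormal_iff_ite.1 hv n k]
  by_cases hk : k = n
  · simp [hk]
  · simp [hk, Ne.symm hk]

section

variable {m ω : ℝ} (hm : 0 < m) (hω : 0 < ω)

lemma inner_evolution (t : ℝ) (x : L2R) (n : ℕ) :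
    ⟪hermiteKet (groundScale m ω) n, evolution hm hω t x⟫_ℂ =
      Complex.exp (((-(energy ω n * t) : ℝ) : ℂ) * Complex.I) *
        ⟪hermiteKet (groundScale m ω) n, x⟫_ℂ :=
  inner_diagonal _ _ _ _ _

lemma evolution_add (s t : ℝ) (x : L2R) :
    evolution hm hω (s + t) x = evolution hm hω s (evolution hm hω t x) := by
  refine ext_inner_hermiteKet (groundScale_pos hm hω) fun n => ?_
  rw [inner_evolution, inner_evolution, inner_evolution, ← mul_assoc, ← Complex.exp_add]
  congr 2
  push_cast
  ring

lemma evolution_zero (x : L2R) : evolution hm hω 0 x = x := by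
  refine ext_inner_hermiteKet (groundScale_pos hm hω) fun n => ?_
  rw [inner_evolution]
  simp

lemma inner_evolution_left (t : ℝ) (x y : L2R) :
    ⟪evolution hm hω t x, y⟫_ℂ = ⟪x, evolution hm hω (-t) y⟫_ℂ := by
  have hb := groundScale_pos hm hω
  refine ((hermiteBasis hb).hasSum_inner_mul_inner _ y).unique
    (((hermiteBasis hb).hasSum_inner_mul_inner x _).congr_fun fun n => ?_)
  rw [hermiteBasis_apply, inner_evolution, ← inner_conj_symm (evolution hm hω t x),
    inner_evolution, map_mul, inner_conj_symm, ← Complex.exp_conj, map_mul, Complex.conj_I,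
    Complex.conj_ofReal]
  push_cast
  ring_nf

lemma adjoint_evolution (t : ℝ) :
    ContinuousLinearMap.adjoint (evolution hm hω t) = evolution hm hω (-t) := by
  refine ((ContinuousLinearMap.eq_adjoint_iff _ _).2 fun x y => ?_).symm
  rw [inner_evolution_left, neg_neg]

lemma dynamics_rankOne (t : ℝ) (x y : L2R) :
    dynamics hm hω t (rankOne ℂ x y) =
      rankOne ℂ (evolution hm hω t x) (evolution hm hω t y) := by
  rw [dynamics, rankOne_comp, adjoint_evolution, neg_neg]
  ext1 z
  simp

lemma dynamics_sum_smul_rankOne {ι : Type*} [Fintype ι] (t : ℝ) (α : ι → ℂ) (x y : ι → L2R) :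
    dynamics hm hω t (∑ i, α i • rankOne ℂ (x i) (y i)) =
      ∑ i, α i • rankOne ℂ (evolution hm hω t (x i)) (evolution hm hω t (y i)) := by
  simp only [← dynamics_rankOne, dynamics]
  ext1 z
  simp [map_sum]

/-- `χ` is `H ψ`. Describing it by its Hermite coefficients avoids handling `H` as an unbounded
operator. -/
lemma exists_inner_eq_energy_mul {m ω : ℝ} (hm : 0 < m) (hω : 0 < ω) {ψ : L2R} (hψ : ψ ∈ hamiltonianDomain m ω) :
    ∃ χ : L2R, ∀ n, ⟪hermiteKet (groundScale m ω) n, χ⟫_ℂ =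
      energy ω n * ⟪hermiteKet (groundScale m ω) n, ψ⟫_ℂ := by
  have hb := groundScale_pos hm hω
  have hmem : Memℓp (fun n => (energy ω n : ℂ) * ⟪hermiteKet (groundScale m ω) n, ψ⟫_ℂ) 2 := by
    refine memℓp_gen (hψ.congr fun n => ?_)
    rw [norm_mul, Complex.norm_real, Real.norm_eq_abs]
    simp [mul_pow]
  refine ⟨(hermiteBasis hb).repr.symm ⟨_, hmem⟩, fun n => ?_⟩
  rw [← hermiteBasis_repr hb, LinearIsometryEquiv.apply_symm_apply]

lemma evolution_mem_hamiltonianDomain {ψ : L2R} (hψ : ψ ∈ hamiltonianDomain m ω) (t : ℝ) :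
    evolution hm hω t ψ ∈ hamiltonianDomain m ω := by
  refine Summable.congr hψ fun n => ?_
  rw [inner_evolution, norm_mul, Complex.norm_exp_ofReal_mul_I, one_mul]

/-- The Schrödinger equation at time zero; `χ` plays the role of `H ψ`. -/
lemma hasDerivAt_evolution_zero {ψ χ : L2R}
    (h : ∀ n, ⟪hermiteKet (groundScale m ω) n, χ⟫_ℂ =
      energy ω n * ⟪hermiteKet (groundScale m ω) n, ψ⟫_ℂ) :
    HasDerivAt (fun t => evolution hm hω t ψ) (-Complex.I • χ) 0 := by
  have hb := groundScale_pos hm hω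
  rw [hasDerivAt_iff_tendsto_slope_zero, tendsto_iff_norm_sub_tendsto_zero]
  have hco : ∀ (t : ℝ) (n : ℕ), ⟪hermiteKet (groundScale m ω) n,
      t⁻¹ • (evolution hm hω (0 + t) ψ - evolution hm hω 0 ψ) - -Complex.I • χ⟫_ℂ =
      (t⁻¹ • (Complex.exp (((-(energy ω n * t) : ℝ) : ℂ) * Complex.I) - 1) +
        Complex.I * energy ω n) * ⟪hermiteKet (groundScale m ω) n, ψ⟫_ℂ := fun t n => by
    rw [inner_sub_right, inner_smul_right, inner_smul_right_eq_smul, inner_sub_right, zero_add,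
      evolution_zero, inner_evolution, h]
    simp only [Complex.real_smul]
    ring
  have hnorm : ∀ t : ℝ, ‖t⁻¹ • (evolution hm hω (0 + t) ψ - evolution hm hω 0 ψ) -
      -Complex.I • χ‖ ^ 2 = ∑' n : ℕ,
      ‖(t⁻¹ • (Complex.exp (((-(energy ω n * t) : ℝ) : ℂ) * Complex.I) - 1) +
        Complex.I * energy ω n) * ⟪hermiteKet (groundScale m ω) n, ψ⟫_ℂ‖ ^ 2 := fun t => by
    rw [← (hasSum_norm_inner_sq (hermiteBasis hb) _).tsum_eq]
    simp only [hermiteBasis_apply, hco]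
  have hE : ∀ n, 0 < energy ω n := fun n => by unfold energy; positivity
  -- Because `|exp(-iEt) - 1| ≤ E|t|`, each coefficient of the error is at most twice that of `χ`.
  -- This dominates the Parseval sum.
  have hsum : Summable fun n => (2 * ‖⟪hermiteKet (groundScale m ω) n, χ⟫_ℂ‖) ^ 2 := by
    simp only [mul_pow]
    have := (hasSum_norm_inner_sq (hermiteBasis hb) χ).summable
    simp only [hermiteBasis_apply] at this
    exact this.mul_left _
  have hlim : Tendsto (fun t : ℝ => ∑' n : ℕ,
      ‖(t⁻¹ • (Complex.exp (((-(energy ω n * t) : ℝ) : ℂ) * Complex.I) - 1) +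
        Complex.I * energy ω n) * ⟪hermiteKet (groundScale m ω) n, ψ⟫_ℂ‖ ^ 2) (𝓝[≠] 0)
      (𝓝 (∑' _ : ℕ, 0)) := by
    refine tendsto_tsum_of_dominated_convergence hsum (fun n => ?_) ?_
    · have hd : HasDerivAt (fun t : ℝ => Complex.exp (((-(energy ω n * t) : ℝ) : ℂ) * Complex.I))
          (-(Complex.I * energy ω n)) 0 := by
        have h1 : HasDerivAt (fun t : ℝ => -(energy ω n * t)) (-energy ω n) 0 := by
          have h2 := ((hasDerivAt_id (0 : ℝ)).const_mul (energy ω n)).fun_neg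
          rwa [mul_one] at h2
        refine (h1.ofReal_comp.mul_const Complex.I).cexp.congr_deriv ?_
        simp [mul_comm]
      rw [hasDerivAt_iff_tendsto_slope_zero] at hd
      have h2 := ((hd.add_const (Complex.I * energy ω n)).mul_const
        ⟪hermiteKet (groundScale m ω) n, ψ⟫_ℂ).norm.pow 2
      simpa using h2
    · filter_upwards [self_mem_nhdsWithin] with t ht n
      have ht' : (0 : ℝ) < |t| := abs_pos.2 ht
      rw [Real.norm_of_nonneg (by positivity), h, norm_mul, norm_mul, Complex.norm_real,
        ← mul_assoc]
      gcongr
      refine (norm_add_le _ _).trans ?_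
      rw [two_mul]
      refine add_le_add ?_ (by simp)
      rw [norm_smul, norm_inv, Real.norm_eq_abs, inv_mul_le_iff₀ ht', mul_comm (_ : ℂ) Complex.I]
      refine (Real.norm_exp_I_mul_ofReal_sub_one_le).trans ?_
      rw [norm_neg, norm_mul, Real.norm_eq_abs t, mul_comm]
  rw [tsum_zero] at hlim
  have := (hlim.congr fun t => (hnorm t).symm).sqrt
  simpa using this

lemma hasDerivAt_evolution {ψ χ : L2R} (t : ℝ)
    (h : ∀ n, ⟪hermiteKet (groundScale m ω) n, χ⟫_ℂ =
      energy ω n * ⟪hermiteKet (groundScale m ω) n, evolution hm hω t ψ⟫_ℂ) :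
    HasDerivAt (fun r => evolution hm hω r ψ) (-Complex.I • χ) t := by
  have h1 := HasDerivAt.scomp_of_eq (h := fun r : ℝ => r - t) t
    (hasDerivAt_evolution_zero hm hω h) ((hasDerivAt_id t).sub_const t) (sub_self t).symm
  rw [one_smul] at h1
  refine h1.congr_of_eventuallyEq (Eventually.of_forall fun r => ?_)
  simp only [Function.comp, ← evolution_add, sub_add_cancel]

end

/-! ### The Hamiltonian on coherent vectors -/

lemma powerSeries_coeff_eq {a b : ℕ → ℂ} {G : ℂ → ℂ}
    (ha : ∀ r, HasSum (fun n => r ^ n * a n) (G r)) (hb : ∀ r, HasSum (fun n => r ^ n * b n) (G r)) :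
    a = b := by
  have h : ∀ {c : ℕ → ℂ}, (∀ r, HasSum (fun n => r ^ n * c n) (G r)) →
      HasFPowerSeriesAt G (FormalMultilinearSeries.ofScalars ℂ c) 0 := fun {c} hc =>
    hasFPowerSeriesAt_iff.2 (Eventually.of_forall fun r => by
      simpa [FormalMultilinearSeries.coeff_ofScalars] using hc r)
  exact FormalMultilinearSeries.ofScalars_series_injective ℂ ℂ
    ((h ha).eq_formalMultilinearSeries (h hb))

/-- The Euler operator `r d/dr` multiplies the `n`-th coefficient by `n`; this is how the
eigenvalues `ω(n + 1/2)` appear on generating functions. -/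
lemma powerSeries_mul_deriv {a : ℕ → ℂ} {G G' : ℂ → ℂ}
    (ha : ∀ r, HasSum (fun n => r ^ n * a n) (G r)) (hG : ∀ r, HasDerivAt G (G' r) r) (r : ℂ) :
    HasSum (fun n => r ^ n * (n * a n)) (r * G' r) := by
  have hd : Differentiable ℂ G := fun r => (hG r).differentiableAt
  have hG' : deriv G = G' := funext fun r => (hG r).deriv
  have hd' : Differentiable ℂ G' := by
    rw [← hG']
    exact fun z => (hd.analyticAt z).deriv.differentiableAt
  have h1 : a = fun n => (n.factorial : ℂ)⁻¹ * iteratedDeriv n G 0 := by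
    refine powerSeries_coeff_eq ha fun r => ?_
    refine (Complex.hasSum_taylorSeries_of_entire hd 0 r).congr_fun fun n => ?_
    rw [sub_zero, smul_eq_mul, smul_eq_mul]
    ring
  have h2 := (Complex.hasSum_taylorSeries_of_entire hd' 0 r).mul_left r
  rw [← hasSum_nat_add_iff' 1]
  simp only [Finset.range_one, Finset.sum_singleton, Nat.cast_zero, zero_mul, mul_zero, sub_zero]
  refine h2.congr_fun fun n => ?_
  have hn : ((n : ℂ) + 1) ≠ 0 := by exact_mod_cast n.succ_ne_zero
  have hf : (n.factorial : ℂ) ≠ 0 := by exact_mod_cast n.factorial_ne_zero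
  rw [h1]
  beta_reduce
  rw [iteratedDeriv_succ', hG', sub_zero, smul_eq_mul, smul_eq_mul, Nat.factorial_succ]
  push_cast
  field_simp
  ring

lemma conj_coherentVecFun (s : ℝ) (r : ℂ) (x : ℝ) :
    starRingEnd ℂ (coherentVecFun s (starRingEnd ℂ r) x) = coherentVecFun s r x := by
  simp [coherentVecFun, ← Complex.exp_conj, map_ofNat (starRingEnd ℂ)]

/-- The overlap of coherent vectors of different length scales is a Gaussian. -/
lemma exists_inner_coherentVec_coherentVec {s σ : ℝ} (hs : 0 < s) (hσ : 0 < σ) :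
    ∃ C : ℂ, ∀ r t : ℂ, ⟪coherentVec s (starRingEnd ℂ r), coherentVec σ t⟫_ℂ =
      C * Complex.exp (s ^ 2 * σ ^ 2 / (s ^ 2 + σ ^ 2) * (r / s + t / σ) ^ 2 -
        r ^ 2 / 2 - t ^ 2 / 2) := by
  have hs' : (s : ℂ) ≠ 0 := by exact_mod_cast hs.ne'
  have hσ' : (σ : ℂ) ≠ 0 := by exact_mod_cast hσ.ne'
  have hsσ : (s : ℂ) ^ 2 + σ ^ 2 ≠ 0 := by
    have : s ^ 2 + σ ^ 2 ≠ 0 := by positivity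
    exact_mod_cast this
  set b : ℂ := ((-(1 / (4 * s ^ 2) + 1 / (4 * σ ^ 2)) : ℝ) : ℂ) with hb
  have hbre : b.re < 0 := by
    rw [hb, Complex.ofReal_re, neg_lt_zero]
    positivity
  have hσs : (σ : ℂ) ^ 2 + s ^ 2 ≠ 0 := by rwa [add_comm]
  refine ⟨((((2 * Real.pi * s ^ 2) ^ (1 / 4 : ℝ))⁻¹ : ℝ) : ℂ) *
    ((((2 * Real.pi * σ ^ 2) ^ (1 / 4 : ℝ))⁻¹ : ℝ) : ℂ) * (Real.pi / -b) ^ (1 / 2 : ℂ),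
    fun r t => ?_⟩
  rw [inner_eq_integral_of_ae_eq (coherentVec_ae_eq hs _) (coherentVec_ae_eq hσ _)]
  have hI : ∀ x : ℝ, starRingEnd ℂ (coherentVecFun s (starRingEnd ℂ r) x) * coherentVecFun σ t x =
      (((((2 * Real.pi * s ^ 2) ^ (1 / 4 : ℝ))⁻¹ : ℝ) : ℂ) *
        ((((2 * Real.pi * σ ^ 2) ^ (1 / 4 : ℝ))⁻¹ : ℝ) : ℂ)) *
      Complex.exp (b * x ^ 2 + (r / s + t / σ) * x + (-(r ^ 2 / 2) - t ^ 2 / 2)) := fun x => by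
    have he : Complex.exp (b * x ^ 2 + (r / s + t / σ) * x + (-(r ^ 2 / 2) - t ^ 2 / 2)) =
        Complex.exp (-(x ^ 2 / (4 * s ^ 2)) + r * (x / s) - r ^ 2 / 2) *
        Complex.exp (-(x ^ 2 / (4 * σ ^ 2)) + t * (x / σ) - t ^ 2 / 2) := by
      rw [← Complex.exp_add, hb]
      congr 1
      push_cast
      ring
    rw [conj_coherentVecFun, he, coherentVecFun, coherentVecFun]
    ring
  simp only [hI]
  rw [integral_const_mul, integral_cexp_quadratic hbre, mul_assoc _ (_ ^ (1 / 2 : ℂ))]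
  congr 3
  rw [hb]
  push_cast
  field_simp
  ring

/-- The vector `H A(t)`, for the coherent vector `A(t)` of length scale `σ`: the Hamiltonian acts on
coherent vectors as a second-order differential operator in the amplitude `t`. -/
def hamiltonianCoherentVec (m ω σ : ℝ) (t : ℂ) : L2R :=
  ((m * ω ^ 2 * σ ^ 2 / 2 - 1 / (8 * m * σ ^ 2) : ℝ) : ℂ) •
      (t ^ 2 • coherentVec σ t + deriv (deriv (coherentVec σ)) t) +
    ((m * ω ^ 2 * σ ^ 2 / 2 + 1 / (8 * m * σ ^ 2) : ℝ) : ℂ) •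
      ((2 * t) • deriv (coherentVec σ) t + coherentVec σ t)

lemma hasDerivAt_coherentVec {σ : ℝ} (hσ : 0 < σ) (t : ℂ) :
    HasDerivAt (coherentVec σ) (deriv (coherentVec σ) t) t :=
  (differentiable_coherentVec hσ t).hasDerivAt

lemma hasDerivAt_deriv_coherentVec {σ : ℝ} (hσ : 0 < σ) (t : ℂ) :
    HasDerivAt (deriv (coherentVec σ)) (deriv (deriv (coherentVec σ)) t) t :=
  ((differentiable_coherentVec hσ).analyticAt t).deriv.differentiableAt.hasDerivAt

/-- Weighted by `r^n/√n!` and summed over `n`, both sides become entire in `r`. The left is `ω(r ∂_r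
+ 1/2)` applied to the Gaussian overlap `F`, the right a second-order operator in `t` applied to
`F`. Both are explicit polynomials times `F`, and they coincide. -/
lemma energy_mul_inner_coherentVec {m ω σ : ℝ} (hm : 0 < m) (hω : 0 < ω) (hσ : 0 < σ) (t : ℂ)
    (n : ℕ) : energy ω n * ⟪hermiteKet (groundScale m ω) n, coherentVec σ t⟫_ℂ =
      ⟪hermiteKet (groundScale m ω) n, hamiltonianCoherentVec m ω σ t⟫_ℂ := by
  have hs := groundScale_pos hm hω
  set s := groundScale m ω with hsdef
  -- Eliminating `m` in favour of `s` removes the square root and leaves a rational identity.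
  have hms : m = 1 / (2 * ω * s ^ 2) := by
    rw [hsdef, groundScale, div_pow, Real.sq_sqrt (by positivity)]
    field_simp
  obtain ⟨C, hC⟩ := exists_inner_coherentVec_coherentVec hs hσ
  have hs' : (s : ℂ) ≠ 0 := by exact_mod_cast hs.ne'
  have hσ' : (σ : ℂ) ≠ 0 := by exact_mod_cast hσ.ne'
  have hω' : (ω : ℂ) ≠ 0 := by exact_mod_cast hω.ne'
  have hsσ : (s : ℂ) ^ 2 + σ ^ 2 ≠ 0 := by
    have : s ^ 2 + σ ^ 2 ≠ 0 := by positivity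
    exact_mod_cast this
  set κ : ℂ := s ^ 2 * σ ^ 2 / (s ^ 2 + σ ^ 2) with hκ
  set F : ℂ → ℂ → ℂ := fun r t => C * Complex.exp (κ * (r / s + t / σ) ^ 2 -
        r ^ 2 / 2 - t ^ 2 / 2) with hF
  have hFr : ∀ r t, HasDerivAt (fun r => F r t) (F r t * (2 * κ / s * (r / s + t / σ) - r)) r :=
      fun r t => by
    have h1 : HasDerivAt (fun r : ℂ => r / s + t / σ) (1 / s) r :=
      ((hasDerivAt_id r).div_const _).add_const _
    have h2 := ((((h1.fun_pow 2).const_mul κ).sub (((hasDerivAt_id r).fun_pow 2).div_const 2)).sub_const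
      (t ^ 2 / 2)).cexp.const_mul C
    refine h2.congr_deriv ?_
    simp only [hF, id, Pi.sub_apply]
    push_cast
    ring
  have hFt : ∀ r t, HasDerivAt (F r) (F r t * (2 * κ / σ * (r / s + t / σ) - t)) t :=
      fun r t => by
    have h1 : HasDerivAt (fun t : ℂ => r / s + t / σ) (1 / σ) t :=
      ((hasDerivAt_id t).div_const _).const_add _
    have h2 := ((((h1.fun_pow 2).const_mul κ).sub_const (r ^ 2 / 2)).sub
      (((hasDerivAt_id t).fun_pow 2).div_const 2)).cexp.const_mul C
    refine h2.congr_deriv ?_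
    simp only [hF, id, Pi.sub_apply]
    push_cast
    ring
  have hFtt : ∀ r t, HasDerivAt (fun t => F r t * (2 * κ / σ * (r / s + t / σ) - t))
      (F r t * ((2 * κ / σ * (r / s + t / σ) - t) ^ 2 + 2 * κ / σ ^ 2 - 1)) t := fun r t => by
    have h1 : HasDerivAt (fun t : ℂ => 2 * κ / σ * (r / s + t / σ) - t)
        (2 * κ / σ * (1 / σ) - 1) t :=
      ((((hasDerivAt_id t).div_const _).const_add _).const_mul _).sub (hasDerivAt_id t)
    refine ((hFt r t).mul h1).congr_deriv ?_
    ring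
  have hA : ∀ r t, ⟪coherentVec s (starRingEnd ℂ r), coherentVec σ t⟫_ℂ = F r t := hC
  have hA' : ∀ r t, ⟪coherentVec s (starRingEnd ℂ r), deriv (coherentVec σ) t⟫_ℂ =
      F r t * (2 * κ / σ * (r / s + t / σ) - t) := fun r t => by
    refine HasDerivAt.unique ?_ (hFt r t)
    refine ((innerSL ℂ (coherentVec s (starRingEnd ℂ r))).hasFDerivAt.comp_hasDerivAt t
      (hasDerivAt_coherentVec hσ t)).congr_of_eventuallyEq (Eventually.of_forall fun z => ?_)
    exact (hA r z).symm
  have hA'' : ∀ r t, ⟪coherentVec s (starRingEnd ℂ r), deriv (deriv (coherentVec σ)) t⟫_ℂ =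
      F r t * ((2 * κ / σ * (r / s + t / σ) - t) ^ 2 + 2 * κ / σ ^ 2 - 1) := fun r t => by
    refine HasDerivAt.unique ?_ (hFtt r t)
    refine ((innerSL ℂ (coherentVec s (starRingEnd ℂ r))).hasFDerivAt.comp_hasDerivAt t
      (hasDerivAt_deriv_coherentVec hσ t)).congr_of_eventuallyEq (Eventually.of_forall fun z => ?_)
    exact (hA' r z).symm
  have hsum : ∀ (f : L2R) (r : ℂ), HasSum (fun n : ℕ => r ^ n * (((√(n.factorial : ℝ) : ℝ) : ℂ)⁻¹ *
      ⟪hermiteKet s n, f⟫_ℂ)) ⟪coherentVec s (starRingEnd ℂ r), f⟫_ℂ := fun f r =>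
    (hasSum_inner_coherentVec_conj hs f r).congr_fun fun n => by ring
  have hd : ∀ r, HasDerivAt (fun r => ⟪coherentVec s (starRingEnd ℂ r), coherentVec σ t⟫_ℂ)
      (F r t * (2 * κ / s * (r / s + t / σ) - r)) r := fun r => by
    simp only [hA]
    exact hFr r t
  have key := powerSeries_coeff_eq
    (G := fun r => ω * (r * (F r t * (2 * κ / s * (r / s + t / σ) - r)) + 1 / 2 * F r t))
    (a := fun n => (((√(n.factorial : ℝ) : ℝ) : ℂ)⁻¹ *
      (energy ω n * ⟪hermiteKet s n, coherentVec σ t⟫_ℂ)))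
    (b := fun n => (((√(n.factorial : ℝ) : ℝ) : ℂ)⁻¹ *
      ⟪hermiteKet s n, hamiltonianCoherentVec m ω σ t⟫_ℂ)) (fun r => ?_) (fun r => ?_)
  · have h := congrFun key n
    have hf0 : ((√(n.factorial : ℝ) : ℝ) : ℂ)⁻¹ ≠ 0 := by
      refine inv_ne_zero ?_
      rw [Complex.ofReal_ne_zero]; positivity
    exact mul_left_cancel₀ hf0 h
  · refine (((powerSeries_mul_deriv (hsum (coherentVec σ t)) hd r).add
      ((hsum (coherentVec σ t) r).mul_left (1 / 2))).mul_left (ω : ℂ)).congr_fun (fun n => ?_)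
      |> fun h => by simpa only [hA] using h
    rw [energy]
    push_cast
    ring
  · have hv : ⟪coherentVec s (starRingEnd ℂ r), hamiltonianCoherentVec m ω σ t⟫_ℂ =
        ω * (r * (F r t * (2 * κ / s * (r / s + t / σ) - r)) + 1 / 2 * F r t) := by
      have hσs : (σ : ℂ) ^ 2 + s ^ 2 ≠ 0 := by rwa [add_comm]
      rw [hamiltonianCoherentVec, inner_add_right, inner_smul_right, inner_smul_right,
        inner_add_right, inner_add_right, inner_smul_right, inner_smul_right, hA, hA', hA'', hms, hκ]
      push_cast
      field_simp
      ring
    rw [← hv]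
    exact hsum _ r

/-! ### Phase-space densities -/

/-- The complex amplitude `q / (2 σ) + i σ p` of the coherent state at `(q, p)`. -/
def amplitude (σ q p : ℝ) : ℂ := q / (2 * σ) + σ * p * Complex.I

/-- The squared normalization of the coherent state at `(q, p)`. -/
def gaussWeight (σ q p : ℝ) : ℝ := Real.exp (-(q ^ 2 / (4 * σ ^ 2)) - σ ^ 2 * p ^ 2)

lemma phaseDensity_eq_inner (σ : ℝ) (V : L2R →L[ℂ] L2R) (q p : ℝ) :
    phaseDensity σ V (q, p) =
      (2 * Real.pi)⁻¹ * (⟪coherentKet σ q p, V (coherentKet σ q p)⟫_ℂ).re := by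
  rw [phaseDensity, trace_comp_rankOne]

lemma inner_coherentKet {σ : ℝ} (hσ : 0 < σ) (V : L2R →L[ℂ] L2R) (q p : ℝ) :
    ⟪coherentKet σ q p, V (coherentKet σ q p)⟫_ℂ = (gaussWeight σ q p : ℂ) *
      ⟪coherentVec σ (amplitude σ q p), V (coherentVec σ (amplitude σ q p))⟫_ℂ := by
  rw [coherentKet_eq hσ, map_smul, inner_smul_left, inner_smul_right, ← mul_assoc,
    ← Complex.exp_conj, ← Complex.exp_add, gaussWeight, Complex.ofReal_exp]
  congr 2
  simp [map_ofNat (starRingEnd ℂ)]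
  ring

lemma phaseDensity_eq {σ : ℝ} (hσ : 0 < σ) (V : L2R →L[ℂ] L2R) (q p : ℝ) :
    phaseDensity σ V (q, p) = (2 * Real.pi)⁻¹ * (gaussWeight σ q p *
      (⟪coherentVec σ (amplitude σ q p), V (coherentVec σ (amplitude σ q p))⟫_ℂ).re) := by
  rw [phaseDensity_eq_inner, inner_coherentKet hσ, Complex.re_ofReal_mul]

/-- Boundedness of `V` is enough: the density is a Gaussian times a bounded form evaluated on an
entire curve. -/
lemma contDiff_phaseDensity {σ : ℝ} (hσ : 0 < σ) (V : L2R →L[ℂ] L2R) :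
    ContDiff ℝ (⊤ : ℕ∞) (phaseDensity σ V) := by
  have ha : ContDiff ℝ (⊤ : ℕ∞) (fun x : ℝ × ℝ => amplitude σ x.1 x.2) := by
    have h1 : ContDiff ℝ (⊤ : ℕ∞) (fun x : ℝ × ℝ => (x.1 : ℂ)) :=
      Complex.ofRealCLM.contDiff.comp contDiff_fst
    have h2 : ContDiff ℝ (⊤ : ℕ∞) (fun x : ℝ × ℝ => (x.2 : ℂ)) :=
      Complex.ofRealCLM.contDiff.comp contDiff_snd
    exact (h1.div_const _).add ((contDiff_const.mul h2).mul contDiff_const)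
  have hA : ContDiff ℝ (⊤ : ℕ∞) (fun x : ℝ × ℝ => coherentVec σ (amplitude σ x.1 x.2)) :=
    ((differentiable_coherentVec hσ).contDiff.restrict_scalars ℝ).comp ha
  have hg : ContDiff ℝ (⊤ : ℕ∞) (fun x : ℝ × ℝ => gaussWeight σ x.1 x.2) := by
    unfold gaussWeight
    fun_prop
  have hVA : ContDiff ℝ (⊤ : ℕ∞) (fun x : ℝ × ℝ => V (coherentVec σ (amplitude σ x.1 x.2))) :=
    (V.restrictScalars ℝ).contDiff.comp hA
  have hI : ContDiff ℝ (⊤ : ℕ∞) (fun x : ℝ × ℝ => ⟪coherentVec σ (amplitude σ x.1 x.2),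
      V (coherentVec σ (amplitude σ x.1 x.2))⟫_ℂ) := hA.inner ℂ hVA
  have hR : ContDiff ℝ (⊤ : ℕ∞) (fun x : ℝ × ℝ => (⟪coherentVec σ (amplitude σ x.1 x.2),
      V (coherentVec σ (amplitude σ x.1 x.2))⟫_ℂ).re) := Complex.reCLM.contDiff.comp hI
  have he : phaseDensity σ V = fun x : ℝ × ℝ => (2 * Real.pi)⁻¹ * (gaussWeight σ x.1 x.2 *
      (⟪coherentVec σ (amplitude σ x.1 x.2), V (coherentVec σ (amplitude σ x.1 x.2))⟫_ℂ).re) :=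
    funext fun x => phaseDensity_eq hσ V x.1 x.2
  rw [he]
  exact contDiff_const.mul (hg.mul hR)

/-! ### Partial derivatives of phase-space densities -/

section

variable {σ : ℝ} (hσ : 0 < σ)

include hσ in
lemma hasDerivAt_coherentVec_fst (q p : ℝ) :
    HasDerivAt (fun q => coherentVec σ (amplitude σ q p))
      ((1 / (2 * σ) : ℂ) • deriv (coherentVec σ) (amplitude σ q p)) q := by
  have h : HasDerivAt (fun q : ℝ => amplitude σ q p) (1 / (2 * σ) : ℂ) q :=
    ((Complex.ofRealCLM.hasDerivAt (x := q)).div_const _).add_const _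
  exact (hasDerivAt_coherentVec hσ _).scomp q h

include hσ in
lemma hasDerivAt_deriv_coherentVec_fst (q p : ℝ) :
    HasDerivAt (fun q => deriv (coherentVec σ) (amplitude σ q p))
      ((1 / (2 * σ) : ℂ) • deriv (deriv (coherentVec σ)) (amplitude σ q p)) q := by
  have h : HasDerivAt (fun q : ℝ => amplitude σ q p) (1 / (2 * σ) : ℂ) q :=
    ((Complex.ofRealCLM.hasDerivAt (x := q)).div_const _).add_const _
  exact (hasDerivAt_deriv_coherentVec hσ _).scomp q h

include hσ in
lemma hasDerivAt_coherentVec_snd (q p : ℝ) :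
    HasDerivAt (fun p => coherentVec σ (amplitude σ q p))
      ((σ * Complex.I : ℂ) • deriv (coherentVec σ) (amplitude σ q p)) p := by
  have h : HasDerivAt (fun p : ℝ => amplitude σ q p) (σ * Complex.I : ℂ) p := by
    refine ((((Complex.ofRealCLM.hasDerivAt (x := p)).const_mul (σ : ℂ)).mul_const
      Complex.I).const_add _).congr_deriv ?_
    simp
  exact (hasDerivAt_coherentVec hσ _).scomp p h

lemma hasDerivAt_gaussWeight_fst (q p : ℝ) :
    HasDerivAt (fun q => gaussWeight σ q p) (gaussWeight σ q p * (-(q / (2 * σ ^ 2)))) q := by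
  refine ((((hasDerivAt_id q).fun_pow 2).div_const (4 * σ ^ 2)).fun_neg.sub_const
    (σ ^ 2 * p ^ 2)).exp.congr_deriv ?_
  simp only [gaussWeight, id]
  ring

lemma hasDerivAt_gaussWeight_snd (q p : ℝ) :
    HasDerivAt (fun p => gaussWeight σ q p) (gaussWeight σ q p * (-(2 * σ ^ 2 * p))) p := by
  refine ((((hasDerivAt_id p).fun_pow 2).const_mul (σ ^ 2)).const_sub
    (-(q ^ 2 / (4 * σ ^ 2)))).exp.congr_deriv ?_
  simp only [gaussWeight, id]
  ring

end

/-- The sesquilinear form of `V` between the coherent vector and `B`, at the amplitude of `(q, p)`. -/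
def coherentForm (σ : ℝ) (V : L2R →L[ℂ] L2R) (B : ℂ → L2R) (q p : ℝ) : ℂ :=
  ⟪coherentVec σ (amplitude σ q p), V (B (amplitude σ q p))⟫_ℂ

lemma hasDerivAt_inner_apply (V : L2R →L[ℂ] L2R) {x y : ℝ → L2R} {x' y' : L2R} {r : ℝ}
    (hx : HasDerivAt x x' r) (hy : HasDerivAt y y' r) :
    HasDerivAt (fun r => ⟪x r, V (y r)⟫_ℂ) (⟪x r, V y'⟫_ℂ + ⟪x', V (y r)⟫_ℂ) r :=
  hx.inner ℂ ((V.restrictScalars ℝ).hasFDerivAt.comp_hasDerivAt r hy)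

section

variable {σ : ℝ} (hσ : 0 < σ) {V : L2R →L[ℂ] L2R} (hV : IsSelfAdjoint V)
include hV

lemma inner_apply_swap (x y : L2R) : ⟪y, V x⟫_ℂ = starRingEnd ℂ ⟪x, V y⟫_ℂ := by
  rw [inner_conj_symm, ← ContinuousLinearMap.adjoint_inner_left, hV.adjoint_eq]

lemma im_inner_apply_self (x : L2R) : (⟪x, V x⟫_ℂ).im = 0 :=
  Complex.conj_eq_iff_im.1 (inner_apply_swap hV x x).symm

include hσ

/-- The two terms of the product rule are complex conjugates because `V` is self-adjoint, so they
add up to twice a real part. -/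
lemma hasDerivAt_coherentForm_re_fst (q p : ℝ) :
    HasDerivAt (fun q => (coherentForm σ V (coherentVec σ) q p).re)
      ((coherentForm σ V (deriv (coherentVec σ)) q p).re / σ) q := by
  have hA := hasDerivAt_coherentVec_fst hσ q p
  refine (Complex.reCLM.hasFDerivAt.comp_hasDerivAt q
    (hasDerivAt_inner_apply V hA hA)).congr_deriv ?_
  rw [map_smul, inner_smul_right, inner_smul_left, inner_apply_swap hV _ (deriv _ _), ← map_mul,
    Complex.reCLM_apply, Complex.add_re, Complex.conj_re, coherentForm]
  have : (1 / (2 * σ) : ℂ) = ((1 / (2 * σ) : ℝ) : ℂ) := by push_cast; rfl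
  rw [this, Complex.re_ofReal_mul]
  field_simp
  ring

/-- As for `q`, but the factor `iσ` from the amplitude turns the real part into an imaginary one. -/
lemma hasDerivAt_coherentForm_re_snd (q p : ℝ) :
    HasDerivAt (fun p => (coherentForm σ V (coherentVec σ) q p).re)
      (-2 * σ * (coherentForm σ V (deriv (coherentVec σ)) q p).im) p := by
  have hA := hasDerivAt_coherentVec_snd hσ q p
  refine (Complex.reCLM.hasFDerivAt.comp_hasDerivAt p
    (hasDerivAt_inner_apply V hA hA)).congr_deriv ?_
  rw [map_smul, inner_smul_right, inner_smul_left, inner_apply_swap hV _ (deriv _ _), ← map_mul,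
    Complex.reCLM_apply, Complex.add_re, Complex.conj_re, coherentForm]
  simp
  ring

/-- The term `⟨A', V A'⟩` is real and drops out, so only the second derivative of `A` survives. -/
lemma hasDerivAt_coherentForm_deriv_im_fst (q p : ℝ) :
    HasDerivAt (fun q => (coherentForm σ V (deriv (coherentVec σ)) q p).im)
      ((coherentForm σ V (deriv (deriv (coherentVec σ))) q p).im / (2 * σ)) q := by
  refine (Complex.imCLM.hasFDerivAt.comp_hasDerivAt q (hasDerivAt_inner_apply V
    (hasDerivAt_coherentVec_fst hσ q p) (hasDerivAt_deriv_coherentVec_fst hσ q p))).congr_deriv ?_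
  have : (1 / (2 * σ) : ℂ) = ((1 / (2 * σ) : ℝ) : ℂ) := by push_cast; rfl
  rw [map_smul, inner_smul_right, inner_smul_left, this, Complex.conj_ofReal,
    Complex.imCLM_apply, Complex.add_im, Complex.im_ofReal_mul, Complex.im_ofReal_mul,
    im_inner_apply_self hV, coherentForm]
  ring

lemma dq_phaseDensity (q p : ℝ) : dq (phaseDensity σ V) (q, p) =
    (2 * Real.pi)⁻¹ * (gaussWeight σ q p *
      (-(q / (2 * σ ^ 2)) * (coherentForm σ V (coherentVec σ) q p).re +
      (coherentForm σ V (deriv (coherentVec σ)) q p).re / σ)) := by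
  have h := ((hasDerivAt_gaussWeight_fst (σ := σ) q p).mul
    (hasDerivAt_coherentForm_re_fst hσ hV q p)).const_mul (2 * Real.pi)⁻¹
  unfold dq
  simp only [phaseDensity_eq hσ]
  refine h.deriv.trans ?_
  ring

lemma dp_phaseDensity (q p : ℝ) : dp (phaseDensity σ V) (q, p) =
    (2 * Real.pi)⁻¹ * (gaussWeight σ q p *
      (-(2 * σ ^ 2 * p) * (coherentForm σ V (coherentVec σ) q p).re -
      2 * σ * (coherentForm σ V (deriv (coherentVec σ)) q p).im)) := by
  have h := ((hasDerivAt_gaussWeight_snd (σ := σ) q p).mul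
    (hasDerivAt_coherentForm_re_snd hσ hV q p)).const_mul (2 * Real.pi)⁻¹
  unfold dp
  simp only [phaseDensity_eq hσ]
  refine h.deriv.trans ?_
  ring

lemma dq_dp_phaseDensity (q p : ℝ) : dq (dp (phaseDensity σ V)) (q, p) =
    (2 * Real.pi)⁻¹ * (gaussWeight σ q p *
      (q * p * (coherentForm σ V (coherentVec σ) q p).re +
      q / σ * (coherentForm σ V (deriv (coherentVec σ)) q p).im -
      2 * σ * p * (coherentForm σ V (deriv (coherentVec σ)) q p).re -
      (coherentForm σ V (deriv (deriv (coherentVec σ))) q p).im)) := by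
  have h := ((hasDerivAt_gaussWeight_fst (σ := σ) q p).mul
    (((hasDerivAt_coherentForm_re_fst hσ hV q p).const_mul (-(2 * σ ^ 2 * p))).sub
    ((hasDerivAt_coherentForm_deriv_im_fst hσ hV q p).const_mul (2 * σ)))).const_mul
      (2 * Real.pi)⁻¹
  rw [dq]
  simp only [dp_phaseDensity hσ hV]
  refine h.deriv.trans ?_
  simp only [Pi.sub_apply]
  field_simp
  ring

end

lemma dq_classicalHamiltonian (m ω : ℝ) (x : ℝ × ℝ) :
    dq (classicalHamiltonian m ω) x = m * ω ^ 2 * x.1 := by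
  have h := (((hasDerivAt_id x.1).fun_pow 2).const_mul (m * ω ^ 2 / 2)).const_add
    (x.2 ^ 2 / (2 * m))
  refine Eq.trans h.deriv ?_
  simp
  ring

lemma dp_classicalHamiltonian (m ω : ℝ) (x : ℝ × ℝ) :
    dp (classicalHamiltonian m ω) x = x.2 / m := by
  have h := (((hasDerivAt_id x.2).fun_pow 2).div_const (2 * m)).add_const
    (m * ω ^ 2 / 2 * x.1 ^ 2)
  refine Eq.trans h.deriv ?_
  simp
  ring

/-- The corrected Liouville operator corresponds to the commutator with the Hamiltonian. -/
lemma correctedLiouville_phaseDensity {m ω σ : ℝ} (hm : 0 < m) (hσ : 0 < σ)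
    {V : L2R →L[ℂ] L2R} (hV : IsSelfAdjoint V) (q p : ℝ) :
    correctedLiouville m ω σ (phaseDensity σ V) (q, p) = (2 * Real.pi)⁻¹ * (gaussWeight σ q p *
      (-2 * (coherentForm σ V (hamiltonianCoherentVec m ω σ) q p).im)) := by
  have hH : coherentForm σ V (hamiltonianCoherentVec m ω σ) q p =
      ((m * ω ^ 2 * σ ^ 2 / 2 - 1 / (8 * m * σ ^ 2) : ℝ) : ℂ) *
        (amplitude σ q p ^ 2 * coherentForm σ V (coherentVec σ) q p +
          coherentForm σ V (deriv (deriv (coherentVec σ))) q p) +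
      ((m * ω ^ 2 * σ ^ 2 / 2 + 1 / (8 * m * σ ^ 2) : ℝ) : ℂ) *
        (2 * amplitude σ q p * coherentForm σ V (deriv (coherentVec σ)) q p +
          coherentForm σ V (coherentVec σ) q p) := by
    simp only [coherentForm, hamiltonianCoherentVec, map_add, map_smul, inner_add_right,
      inner_smul_right]
  have h0 : (coherentForm σ V (coherentVec σ) q p).im = 0 := im_inner_apply_self hV _
  have ha : amplitude σ q p = ((q / (2 * σ) : ℝ) : ℂ) + ((σ * p : ℝ) : ℂ) * Complex.I := by
    rw [amplitude]; push_cast; rfl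
  -- Both sides are now linear in `⟨A, VA⟩`, the real and imaginary parts of `⟨A, VA'⟩`, and `Im ⟨A,
  -- VA''⟩`. The last matches because the `A''` coefficient of `H A` is half that of the mixed
  -- derivative.
  rw [correctedLiouville, poisson, dq_dp_phaseDensity hσ hV, dq_phaseDensity hσ hV,
    dp_phaseDensity hσ hV, dq_classicalHamiltonian, dp_classicalHamiltonian, hH, ha]
  simp only [Complex.add_im, Complex.mul_im, Complex.mul_re, pow_two,
    Complex.add_re, Complex.ofReal_re, Complex.ofReal_im, Complex.I_re, Complex.I_im, h0,
    Complex.re_ofNat, Complex.im_ofNat]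
  field_simp
  ring

/-! ### Injectivity of the classical representation -/

lemma phaseDensity_sub (σ : ℝ) (V V' : L2R →L[ℂ] L2R) (x : ℝ × ℝ) :
    phaseDensity σ (V - V') x = phaseDensity σ V x - phaseDensity σ V' x := by
  obtain ⟨q, p⟩ := x
  simp only [phaseDensity_eq_inner, sub_apply, inner_sub_right, Complex.sub_re]
  ring

lemma amplitude_surjective {σ : ℝ} (hσ : 0 < σ) (t : ℂ) :
    amplitude σ (2 * σ * t.re) (t.im / σ) = t := by
  have hσ' : (σ : ℂ) ≠ 0 := by exact_mod_cast hσ.ne'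
  conv_rhs => rw [← Complex.re_add_im t]
  rw [amplitude]
  push_cast
  field_simp

lemma gaussWeight_pos (σ q p : ℝ) : 0 < gaussWeight σ q p := Real.exp_pos _

/-- An entire function vanishing on the real line vanishes. -/
lemma eq_zero_of_forall_ofReal {f : ℂ → ℂ} (hf : Differentiable ℂ f) (h : ∀ x : ℝ, f x = 0)
    (z : ℂ) : f z = 0 := by
  have hfr : ∃ᶠ z in 𝓝[≠] (0 : ℂ), f z = 0 := by
    have ht : Tendsto (fun x : ℝ => (x : ℂ)) (𝓝[≠] 0) (𝓝[≠] 0) := by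
      refine tendsto_nhdsWithin_iff.2 ⟨?_, ?_⟩
      · exact (Complex.continuous_ofReal.tendsto' 0 0 Complex.ofReal_zero).mono_left
          nhdsWithin_le_nhds
      · filter_upwards [self_mem_nhdsWithin] with x hx
        simpa using hx
    exact ht.frequently (Eventually.of_forall h).frequently
  exact (hf.differentiableOn.analyticOnNhd isOpen_univ).eqOn_zero_of_preconnected_of_frequently_eq_zero
    isPreconnected_univ (Set.mem_univ 0) hfr (Set.mem_univ z)

/-- The bra of the coherent vector of conjugate amplitude depends holomorphically on the
amplitude. -/
lemma differentiable_innerSL_coherentVec_conj {σ : ℝ} (hσ : 0 < σ) :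
    Differentiable ℂ fun z => innerSL ℂ (coherentVec σ (starRingEnd ℂ z)) := by
  intro z
  refine HasDerivAt.differentiableAt
    (f' := innerSL ℂ (deriv (coherentVec σ) (starRingEnd ℂ z))) ?_
  rw [hasDerivAt_iff_isLittleO]
  have h := hasDerivAt_iff_isLittleO.1 (hasDerivAt_coherentVec hσ (starRingEnd ℂ z))
  have h' := h.comp_tendsto (Complex.continuous_conj.tendsto z)
  refine (Asymptotics.IsLittleO.congr' (h'.norm_norm) ?_ ?_).of_norm_norm
  · refine Eventually.of_forall fun w => ?_
    have : innerSL ℂ (coherentVec σ (starRingEnd ℂ w)) - innerSL ℂ (coherentVec σ (starRingEnd ℂ z)) -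
        (w - z) • innerSL ℂ (deriv (coherentVec σ) (starRingEnd ℂ z)) =
        innerSL ℂ (coherentVec σ (starRingEnd ℂ w) - coherentVec σ (starRingEnd ℂ z) -
          (starRingEnd ℂ w - starRingEnd ℂ z) • deriv (coherentVec σ) (starRingEnd ℂ z)) := by
      ext v
      simp
    beta_reduce
    rw [this, innerSL_apply_norm]
    rfl
  · refine Eventually.of_forall fun w => ?_
    simp only [Function.comp, ← map_sub, RCLike.norm_conj]

/-- The kernel `⟨A(z̄), D A(w)⟩` is entire in `(z, w)` and vanishes at `(x - iy, x + iy)` for real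
`x, y`. The identity theorem, applied in `x` and then in `y`, makes it vanish everywhere; totality
of the coherent vectors does the rest. -/
lemma eq_zero_of_forall_inner_coherentVec_apply {σ : ℝ} (hσ : 0 < σ) {D : L2R →L[ℂ] L2R}
    (h : ∀ t, ⟪coherentVec σ t, D (coherentVec σ t)⟫_ℂ = 0) : D = 0 := by
  have hK : Differentiable ℂ fun zw : ℂ × ℂ =>
      innerSL ℂ (coherentVec σ (starRingEnd ℂ zw.1)) (D (coherentVec σ zw.2)) :=
    ((differentiable_innerSL_coherentVec_conj hσ).comp differentiable_fst).clm_apply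
      (D.differentiable.comp ((differentiable_coherentVec hσ).comp differentiable_snd))
  have hreal : ∀ x y : ℝ, innerSL ℂ (coherentVec σ (starRingEnd ℂ (x - y * Complex.I)))
      (D (coherentVec σ (x + y * Complex.I))) = 0 := fun x y => by
    rw [innerSL_apply_apply, ← h (x + y * Complex.I)]
    congr 3
    simp
  have hx : ∀ (x : ℂ) (y : ℝ), innerSL ℂ (coherentVec σ (starRingEnd ℂ (x - y * Complex.I)))
      (D (coherentVec σ (x + y * Complex.I))) = 0 := fun x y => by
    refine eq_zero_of_forall_ofReal (f := fun x => innerSL ℂ (coherentVec σ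
      (starRingEnd ℂ (x - y * Complex.I))) (D (coherentVec σ (x + y * Complex.I)))) ?_
      (fun x => hreal x y) x
    exact hK.comp (f := fun x : ℂ => (x - y * Complex.I, x + y * Complex.I)) (by fun_prop)
  have hxy : ∀ x y : ℂ, innerSL ℂ (coherentVec σ (starRingEnd ℂ (x - y * Complex.I)))
      (D (coherentVec σ (x + y * Complex.I))) = 0 := fun x y => by
    refine eq_zero_of_forall_ofReal (f := fun y => innerSL ℂ (coherentVec σ
      (starRingEnd ℂ (x - y * Complex.I))) (D (coherentVec σ (x + y * Complex.I)))) ?_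
      (fun y => hx x y) y
    exact hK.comp (f := fun y : ℂ => (x - y * Complex.I, x + y * Complex.I)) (by fun_prop)
  have hzw : ∀ z w : ℂ, ⟪coherentVec σ z, D (coherentVec σ w)⟫_ℂ = 0 := fun z w => by
    -- These complex values of `x` and `y` solve `x - iy = z̄`, `x + iy = w`.
    have := hxy ((starRingEnd ℂ z + w) / 2) (-Complex.I * (w - starRingEnd ℂ z) / 2)
    have h1 : (starRingEnd ℂ z + w) / 2 - -Complex.I * (w - starRingEnd ℂ z) / 2 * Complex.I =
        starRingEnd ℂ z := by
      linear_combination ((w - starRingEnd ℂ z) / 2) * Complex.I_sq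
    have h2 : (starRingEnd ℂ z + w) / 2 + -Complex.I * (w - starRingEnd ℂ z) / 2 * Complex.I =
        w := by
      linear_combination (-(w - starRingEnd ℂ z) / 2) * Complex.I_sq
    rwa [h1, h2, Complex.conj_conj, innerSL_apply_apply] at this
  have hDA : ∀ w, D (coherentVec σ w) = 0 := fun w =>
    eq_zero_of_forall_inner_coherentVec hσ _ fun z => inner_eq_zero_symm.1 (hzw z w)
  have hadj : ∀ f, ContinuousLinearMap.adjoint D f = 0 := fun f =>
    eq_zero_of_forall_inner_coherentVec hσ _ fun w => by
      rw [ContinuousLinearMap.adjoint_inner_left, hDA, inner_zero_right]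
  have h0 : ContinuousLinearMap.adjoint D = 0 := by
    ext1 f
    exact hadj f
  simpa using h0

/-- Continuity turns almost everywhere into everywhere, every complex number is an amplitude, and
self-adjointness supplies the imaginary part, which the density does not see. -/
lemma phaseDensity_injective {σ : ℝ} (hσ : 0 < σ) {V V' : L2R →L[ℂ] L2R} (hV : IsSelfAdjoint V)
    (hV' : IsSelfAdjoint V') (h : phaseDensity σ V =ᵐ[volume] phaseDensity σ V') : V = V' := by
  have hEq : phaseDensity σ V = phaseDensity σ V' :=
    (Continuous.ae_eq_iff_eq volume (contDiff_phaseDensity hσ V).continuous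
      (contDiff_phaseDensity hσ V').continuous).1 h
  rw [← sub_eq_zero]
  refine eq_zero_of_forall_inner_coherentVec_apply hσ fun t => ?_
  have h0 := phaseDensity_sub σ V V' (2 * σ * t.re, t.im / σ)
  rw [hEq, sub_self, phaseDensity_eq hσ, amplitude_surjective hσ] at h0
  refine Complex.ext ?_ (im_inner_apply_self (hV.sub hV') _)
  have hpi : (2 * Real.pi)⁻¹ ≠ 0 := by positivity
  exact (mul_eq_zero.1 ((mul_eq_zero.1 h0).resolve_left hpi)).resolve_left
    (gaussWeight_pos _ _ _).ne'

/-! ### Square integrability of coherent amplitudes over phase space -/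

lemma norm_conj_pow_mul_pow_mul_exp (n k : ℕ) (t : ℂ) :
    ‖starRingEnd ℂ t ^ n * t ^ k * (Real.exp (-‖t‖ ^ 2) : ℂ)‖ =
      ‖t‖ ^ ((n + k : ℕ) : ℝ) * Real.exp (-‖t‖ ^ (2 : ℝ)) := by
  rw [norm_mul, norm_mul, norm_pow, norm_pow, RCLike.norm_conj, ← pow_add, Complex.norm_real,
    Real.norm_of_nonneg (Real.exp_pos _).le, Real.rpow_natCast, Real.rpow_two]

lemma integral_norm_pow_mul_exp (j : ℕ) :
    ∫ t : ℂ, ‖t‖ ^ (j : ℝ) * Real.exp (-‖t‖ ^ (2 : ℝ)) =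
      Real.pi * Real.Gamma (((j : ℝ) + 2) / 2) := by
  rw [Complex.integral_rpow_mul_exp_neg_rpow one_le_two (by linarith [j.cast_nonneg (α := ℝ)])]
  ring

lemma integrable_conj_pow_mul_pow_mul_exp (n k : ℕ) :
    Integrable fun t : ℂ => starRingEnd ℂ t ^ n * t ^ k * (Real.exp (-‖t‖ ^ 2) : ℂ) := by
  refine (integrable_norm_iff (Continuous.aestronglyMeasurable (by fun_prop))).1 ?_
  simp only [norm_conj_pow_mul_pow_mul_exp]
  refine Integrable.of_integral_ne_zero ?_
  rw [integral_norm_pow_mul_exp]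
  have : 0 < Real.Gamma ((((n + k : ℕ) : ℝ) + 2) / 2) := Real.Gamma_pos_of_pos (by positivity)
  positivity

/-- The monomials are orthogonal with respect to the Gaussian measure of the complex plane. -/
lemma integral_conj_pow_mul_pow_mul_exp (n k : ℕ) :
    ∫ t : ℂ, starRingEnd ℂ t ^ n * t ^ k * (Real.exp (-‖t‖ ^ 2) : ℂ) =
      if n = k then ((Real.pi * n.factorial : ℝ) : ℂ) else 0 := by
  split_ifs with h
  · subst h
    have h1 : ∀ t : ℂ, starRingEnd ℂ t ^ n * t ^ n * (Real.exp (-‖t‖ ^ 2) : ℂ) =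
        ((‖t‖ ^ ((2 * n : ℕ) : ℝ) * Real.exp (-‖t‖ ^ (2 : ℝ)) : ℝ) : ℂ) := fun t => by
      rw [← mul_pow, Complex.conj_mul', Real.rpow_natCast, Real.rpow_two, pow_mul]
      push_cast
      rfl
    simp only [h1]
    rw [integral_complex_ofReal, integral_norm_pow_mul_exp, ← Real.Gamma_nat_eq_factorial]
    congr 3
    push_cast
    ring
  · have hnk : ((k : ℂ) - n) ≠ 0 := by
      rw [sub_ne_zero, Ne, Nat.cast_inj]
      exact fun h' => h h'.symm
    -- Rotation by this angle preserves Lebesgue measure and multiplies the integrand by `-1`, so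
    -- the integral equals its own negative.
    set θ : ℝ := Real.pi / ((k : ℝ) - n) with hθ
    set c : Circle := Circle.exp θ
    have hmp := (rotation c).measurePreserving
    have hrot := hmp.integral_comp (rotation c).toHomeomorph.measurableEmbedding
      (fun t : ℂ => starRingEnd ℂ t ^ n * t ^ k * (Real.exp (-‖t‖ ^ 2) : ℂ))
    have hc : starRingEnd ℂ (c : ℂ) ^ n * (c : ℂ) ^ k = -1 := by
      rw [Circle.coe_exp, ← Complex.exp_conj, ← Complex.exp_nat_mul, ← Complex.exp_nat_mul,
        ← Complex.exp_add, ← Complex.exp_pi_mul_I]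
      congr 1
      rw [map_mul, Complex.conj_ofReal, Complex.conj_I, hθ]
      push_cast
      field_simp
      ring
    have h2 : ∀ t : ℂ, starRingEnd ℂ (rotation c t) ^ n * rotation c t ^ k *
        (Real.exp (-‖rotation c t‖ ^ 2) : ℂ) =
        -(starRingEnd ℂ t ^ n * t ^ k * (Real.exp (-‖t‖ ^ 2) : ℂ)) := fun t => by
      rw [LinearIsometryEquiv.norm_map, rotation_apply, map_mul, mul_pow, mul_pow]
      linear_combination (starRingEnd ℂ t ^ n * t ^ k * (Real.exp (-‖t‖ ^ 2) : ℂ)) * hc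
    simp only [h2] at hrot
    rw [integral_neg] at hrot
    linear_combination (-1 / 2 : ℂ) * hrot

lemma integral_norm_sum_sq_mul_exp (a : ℕ → ℂ) (s : Finset ℕ) :
    ∫ t : ℂ, ((‖∑ n ∈ s, a n * t ^ n‖ ^ 2 * Real.exp (-‖t‖ ^ 2) : ℝ) : ℂ) =
      ((∑ n ∈ s, Real.pi * n.factorial * ‖a n‖ ^ 2 : ℝ) : ℂ) := by
  have h1 : ∀ t : ℂ, ((‖∑ n ∈ s, a n * t ^ n‖ ^ 2 * Real.exp (-‖t‖ ^ 2) : ℝ) : ℂ) =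
      ∑ n ∈ s, ∑ k ∈ s, starRingEnd ℂ (a n) * a k *
        (starRingEnd ℂ t ^ n * t ^ k * (Real.exp (-‖t‖ ^ 2) : ℂ)) := fun t => by
    rw [Complex.ofReal_mul, Complex.ofReal_pow, ← Complex.conj_mul', map_sum, Finset.sum_mul_sum,
      Finset.sum_mul]
    refine Finset.sum_congr rfl fun n _ => ?_
    rw [Finset.sum_mul]
    refine Finset.sum_congr rfl fun k _ => ?_
    rw [map_mul, map_pow]
    ring
  simp only [h1]
  rw [integral_finsetSum _ fun n _ => integrable_finsetSum _ fun k _ =>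
    (integrable_conj_pow_mul_pow_mul_exp n k).const_mul _, Complex.ofReal_sum]
  refine Finset.sum_congr rfl fun n hn => ?_
  rw [integral_finsetSum _ fun k _ => (integrable_conj_pow_mul_pow_mul_exp n k).const_mul _]
  simp only [integral_const_mul, integral_conj_pow_mul_pow_mul_exp, mul_ite, mul_zero]
  rw [Finset.sum_ite_eq, if_pos hn, Complex.conj_mul']
  push_cast
  ring

lemma lintegral_norm_sum_sq_mul_exp (a : ℕ → ℂ) (s : Finset ℕ) :
    ∫⁻ t : ℂ, ENNReal.ofReal (‖∑ n ∈ s, a n * t ^ n‖ ^ 2 * Real.exp (-‖t‖ ^ 2)) =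
      ENNReal.ofReal (∑ n ∈ s, Real.pi * n.factorial * ‖a n‖ ^ 2) := by
  have h := integral_norm_sum_sq_mul_exp a s
  rw [integral_complex_ofReal, Complex.ofReal_inj] at h
  rw [← h, ofReal_integral_eq_lintegral_ofReal _ (Eventually.of_forall fun t => by positivity)]
  have h1 : ∀ t : ℂ, ‖∑ n ∈ s, a n * t ^ n‖ ^ 2 * Real.exp (-‖t‖ ^ 2) =
      (∑ n ∈ s, ∑ k ∈ s, starRingEnd ℂ (a n) * a k *
        (starRingEnd ℂ t ^ n * t ^ k * (Real.exp (-‖t‖ ^ 2) : ℂ))).re := fun t => by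
    rw [← Complex.ofReal_re (_ * _), Complex.ofReal_mul, Complex.ofReal_pow, ← Complex.conj_mul',
      map_sum, Finset.sum_mul_sum, Finset.sum_mul]
    congr 1
    refine Finset.sum_congr rfl fun n _ => ?_
    rw [Finset.sum_mul]
    refine Finset.sum_congr rfl fun k _ => ?_
    rw [map_mul, map_pow]
    ring
  simp only [h1]
  exact Integrable.re (integrable_finsetSum _ fun n _ => integrable_finsetSum _ fun k _ =>
    (integrable_conj_pow_mul_pow_mul_exp n k).const_mul _)

lemma amplitude_eq (σ q p : ℝ) :
    amplitude σ q p = ((q / (2 * σ) : ℝ) : ℂ) + ((σ * p : ℝ) : ℂ) * Complex.I := by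
  rw [amplitude]; push_cast; rfl

lemma gaussWeight_eq (σ q p : ℝ) : gaussWeight σ q p = Real.exp (-‖amplitude σ q p‖ ^ 2) := by
  rw [gaussWeight, ← Complex.normSq_eq_norm_sq, amplitude_eq, Complex.normSq_add_mul_I]
  congr 1
  ring

section

variable {σ : ℝ} (hσ : 0 < σ)
include hσ

lemma hasSum_inner_coherentVec (f : L2R) (t : ℂ) :
    HasSum (fun n : ℕ => ⟪f, hermiteKet σ n⟫_ℂ / ((√(n.factorial : ℝ) : ℝ) : ℂ) * t ^ n)
      ⟪f, coherentVec σ t⟫_ℂ := by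
  refine ((hasSum_coherentVec hσ t).mapL (innerSL ℂ f)).congr_fun fun n => ?_
  rw [innerSL_apply_apply, inner_smul_right]
  ring

/-- Orthogonality of monomials evaluates the partial sums exactly, Bessel bounds them, and Fatou
passes to the limit. -/
lemma lintegral_norm_inner_coherentVec_sq_le (f : L2R) :
    ∫⁻ t : ℂ, ENNReal.ofReal (‖⟪f, coherentVec σ t⟫_ℂ‖ ^ 2 * Real.exp (-‖t‖ ^ 2)) ≤
      ENNReal.ofReal (Real.pi * ‖f‖ ^ 2) := by
  set a : ℕ → ℂ := fun n => ⟪f, hermiteKet σ n⟫_ℂ / ((√(n.factorial : ℝ) : ℝ) : ℂ) with ha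
  have hlim : ∀ t : ℂ, Tendsto (fun N : ℕ => ENNReal.ofReal
      (‖∑ n ∈ Finset.range N, a n * t ^ n‖ ^ 2 * Real.exp (-‖t‖ ^ 2))) atTop
      (𝓝 (ENNReal.ofReal (‖⟪f, coherentVec σ t⟫_ℂ‖ ^ 2 * Real.exp (-‖t‖ ^ 2)))) := fun t =>
    (ENNReal.continuous_ofReal.tendsto _).comp
      (((hasSum_inner_coherentVec hσ f t).tendsto_sum_nat.norm.pow 2).mul_const _)
  have hbound : ∀ N : ℕ, ∑ n ∈ Finset.range N, Real.pi * n.factorial * ‖a n‖ ^ 2 ≤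
      Real.pi * ‖f‖ ^ 2 := fun N => by
    have h := (orthonormal_hermiteKet hσ).sum_inner_products_le f (s := Finset.range N)
    refine le_trans (le_of_eq ?_) (mul_le_mul_of_nonneg_left h Real.pi_pos.le)
    rw [Finset.mul_sum]
    refine Finset.sum_congr rfl fun n _ => ?_
    have hf : (n.factorial : ℝ) ≠ 0 := by exact_mod_cast n.factorial_ne_zero
    rw [ha]
    beta_reduce
    rw [norm_div, Complex.norm_real, Real.norm_of_nonneg (Real.sqrt_nonneg _), div_pow,
      Real.sq_sqrt (by positivity), norm_inner_symm]
    field_simp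
  calc _ = ∫⁻ t : ℂ, liminf (fun N : ℕ => ENNReal.ofReal
      (‖∑ n ∈ Finset.range N, a n * t ^ n‖ ^ 2 * Real.exp (-‖t‖ ^ 2))) atTop :=
        lintegral_congr fun t => (hlim t).liminf_eq.symm
    _ ≤ liminf (fun N : ℕ => ∫⁻ t : ℂ, ENNReal.ofReal
      (‖∑ n ∈ Finset.range N, a n * t ^ n‖ ^ 2 * Real.exp (-‖t‖ ^ 2))) atTop :=
        lintegral_liminf_le fun N => by fun_prop
    _ ≤ liminf (fun _ : ℕ => ENNReal.ofReal (Real.pi * ‖f‖ ^ 2)) atTop :=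
        liminf_le_liminf (Eventually.of_forall fun N => by
          rw [lintegral_norm_sum_sq_mul_exp]
          exact ENNReal.ofReal_le_ofReal (hbound N))
    _ = _ := liminf_const _

/-- Phase space as the complex plane of amplitudes. -/
def amplitudeEquiv : (ℝ × ℝ) ≃L[ℝ] ℂ :=
  LinearEquiv.toContinuousLinearEquiv
    { toFun := fun x => amplitude σ x.1 x.2
      map_add' := fun x y => by
        simp only [amplitude, Prod.fst_add, Prod.snd_add]
        push_cast
        ring
      map_smul' := fun c x => by
        simp only [amplitude, Prod.smul_fst, Prod.smul_snd, smul_eq_mul, RingHom.id_apply,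
          Complex.real_smul]
        push_cast
        ring
      invFun := fun t => (2 * σ * t.re, t.im / σ)
      left_inv := fun x => by
        simp only [amplitude_eq]
        ext
        · simp only [Complex.add_re, Complex.ofReal_re, Complex.re_ofReal_mul, Complex.I_re]
          field_simp
          ring
        · simp only [Complex.add_im, Complex.ofReal_im, Complex.im_ofReal_mul, Complex.I_im]
          field_simp
          ring
      right_inv := fun t => amplitude_surjective hσ t }

/-- The amplitude is a linear isomorphism onto `ℂ`, so it changes Lebesgue measure only by a
constant factor, whose value does not matter. -/
lemma exists_lintegral_amplitude_le : ∃ C : ℝ, 0 ≤ C ∧ ∀ f : L2R,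
    ∫⁻ x : ℝ × ℝ, ENNReal.ofReal (gaussWeight σ x.1 x.2 *
      ‖⟪f, coherentVec σ (amplitude σ x.1 x.2)⟫_ℂ‖ ^ 2) ≤ ENNReal.ofReal (C * ‖f‖ ^ 2) := by
  set T := amplitudeEquiv hσ
  have : (Measure.map T (volume : Measure (ℝ × ℝ))).IsAddHaarMeasure :=
    T.isAddHaarMeasure_map volume
  set c := Measure.addHaarScalarFactor (Measure.map T (volume : Measure (ℝ × ℝ)))
    (volume : Measure ℂ)
  have hc : Measure.map T (volume : Measure (ℝ × ℝ)) = c • (volume : Measure ℂ) :=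
    Measure.isAddLeftInvariant_eq_smul _ _
  refine ⟨c * Real.pi, by positivity, fun f => ?_⟩
  calc _ = ∫⁻ x : ℝ × ℝ, ENNReal.ofReal
        (‖⟪f, coherentVec σ (T x)⟫_ℂ‖ ^ 2 * Real.exp (-‖T x‖ ^ 2)) :=
        lintegral_congr fun x => by
          rw [gaussWeight_eq, mul_comm]
          rfl
    _ = ∫⁻ t, ENNReal.ofReal (‖⟪f, coherentVec σ t⟫_ℂ‖ ^ 2 * Real.exp (-‖t‖ ^ 2))
        ∂(Measure.map T (volume : Measure (ℝ × ℝ))) :=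
        (MeasurableEmbedding.lintegral_map (g := T) T.toHomeomorph.measurableEmbedding fun t =>
          ENNReal.ofReal (‖⟪f, coherentVec σ t⟫_ℂ‖ ^ 2 * Real.exp (-‖t‖ ^ 2))).symm
    _ ≤ c * ENNReal.ofReal (Real.pi * ‖f‖ ^ 2) := by
        rw [hc, lintegral_smul_measure]
        exact mul_le_mul_right (lintegral_norm_inner_coherentVec_sq_le hσ f) _
    _ = _ := by
        rw [mul_assoc, ENNReal.ofReal_mul (by positivity : (0:ℝ) ≤ c), ENNReal.ofReal_coe_nnreal]

end

/-! ### Derivatives of bilinear curves and the generator of the dynamics -/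

lemma hasDerivAt_of_isBoundedBilinearMap {E F : Type*} [NormedAddCommGroup E] [NormedSpace ℝ E]
    [NormedAddCommGroup F] [NormedSpace ℝ F] {b : E × E → F} (hb : IsBoundedBilinearMap ℝ b)
    {x : ℝ → E} {x' : E} {t : ℝ} (hx : HasDerivAt x x' t) :
    HasDerivAt (fun s => b (x s, x s)) (b (x t, x') + b (x', x t)) t :=
  HasFDerivAt.comp_hasDerivAt (f := fun s => (x s, x s)) t (hb.hasFDerivAt (x t, x t))
    (hx.prodMk hx)

/-- Bilinearity holds over `ℝ` only, the second slot being conjugate linear; this suffices for time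
derivatives. -/
lemma isBoundedBilinearMap_rankOne {E : Type*} [NormedAddCommGroup E] [InnerProductSpace ℂ E] :
    IsBoundedBilinearMap ℝ fun x : E × E => (rankOne ℂ x.1 x.2 : E →L[ℂ] E) where
  add_left x y z := by simp
  smul_left c x y := by
    ext z
    rw [rankOne_apply, smul_apply, rankOne_apply, smul_comm]
  add_right x y z := by simp
  smul_right c x y := by
    ext z
    rw [rankOne_apply, smul_apply, rankOne_apply, inner_smul_left_eq_smul, smul_assoc]
  bound := ⟨1, one_pos, fun x y => by simp⟩

lemma toL1_congr {f g : ℝ × ℝ → ℝ} (hf : Integrable f) (hg : Integrable g) (h : f = g) :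
    hf.toL1 f = hg.toL1 g := by
  subst h
  rfl

section

variable {σ : ℝ} (hσ : 0 < σ)
include hσ

lemma phaseDensity_rankOne (x y : L2R) (q p : ℝ) :
    phaseDensity σ (rankOne ℂ x y) (q, p) = (2 * Real.pi)⁻¹ * (gaussWeight σ q p *
      (⟪y, coherentVec σ (amplitude σ q p)⟫_ℂ * ⟪coherentVec σ (amplitude σ q p), x⟫_ℂ).re) := by
  rw [phaseDensity_eq hσ, rankOne_apply, inner_smul_right]

lemma abs_phaseDensity_rankOne_le (x y : L2R) (q p : ℝ) :
    ‖phaseDensity σ (rankOne ℂ x y) (q, p)‖ ≤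
      gaussWeight σ q p * ‖⟪x, coherentVec σ (amplitude σ q p)⟫_ℂ‖ ^ 2 +
      gaussWeight σ q p * ‖⟪y, coherentVec σ (amplitude σ q p)⟫_ℂ‖ ^ 2 := by
  have hg := (gaussWeight_pos σ q p).le
  have hpi : (2 * Real.pi)⁻¹ ≤ 1 := inv_le_one_of_one_le₀ (by linarith [Real.pi_gt_three])
  set a := ‖⟪x, coherentVec σ (amplitude σ q p)⟫_ℂ‖ with ha
  set b := ‖⟪y, coherentVec σ (amplitude σ q p)⟫_ℂ‖ with hb
  have h1 : ‖(⟪y, coherentVec σ (amplitude σ q p)⟫_ℂ *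
      ⟪coherentVec σ (amplitude σ q p), x⟫_ℂ).re‖ ≤ a ^ 2 + b ^ 2 := by
    refine (Complex.abs_re_le_norm _).trans ?_
    rw [norm_mul, norm_inner_symm (coherentVec _ _) x, ← ha, ← hb]
    nlinarith [sq_nonneg (a - b), sq_nonneg a, sq_nonneg b]
  rw [phaseDensity_rankOne hσ, norm_mul, norm_mul, Real.norm_of_nonneg hg,
    Real.norm_of_nonneg (by positivity), ← mul_add]
  calc _ ≤ 1 * (gaussWeight σ q p * (a ^ 2 + b ^ 2)) := by gcongr
    _ = _ := one_mul _

lemma exists_lintegral_phaseDensity_rankOne_le : ∃ C : ℝ, 0 ≤ C ∧ ∀ x y : L2R,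
    ∫⁻ z, ‖phaseDensity σ (rankOne ℂ x y) z‖ₑ ≤ ENNReal.ofReal (C * (‖x‖ ^ 2 + ‖y‖ ^ 2)) := by
  obtain ⟨C, hC, h⟩ := exists_lintegral_amplitude_le hσ
  refine ⟨C, hC, fun x y => ?_⟩
  have hm : Measurable fun z : ℝ × ℝ => ENNReal.ofReal (gaussWeight σ z.1 z.2 *
      ‖⟪x, coherentVec σ (amplitude σ z.1 z.2)⟫_ℂ‖ ^ 2) := by
    refine ENNReal.measurable_ofReal.comp (Continuous.measurable ?_)
    have h1 : Continuous fun z : ℝ × ℝ => coherentVec σ (amplitude σ z.1 z.2) :=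
      (differentiable_coherentVec hσ).continuous.comp (amplitudeEquiv hσ).continuous
    unfold gaussWeight
    fun_prop
  calc _ ≤ ∫⁻ z : ℝ × ℝ, (ENNReal.ofReal (gaussWeight σ z.1 z.2 *
        ‖⟪x, coherentVec σ (amplitude σ z.1 z.2)⟫_ℂ‖ ^ 2) + ENNReal.ofReal (gaussWeight σ z.1 z.2 *
        ‖⟪y, coherentVec σ (amplitude σ z.1 z.2)⟫_ℂ‖ ^ 2)) := lintegral_mono fun z => by
          have hg := (gaussWeight_pos σ z.1 z.2).le
          rw [← ENNReal.ofReal_add (by positivity) (by positivity), ← ofReal_norm]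
          exact ENNReal.ofReal_le_ofReal (abs_phaseDensity_rankOne_le hσ x y z.1 z.2)
    _ ≤ ENNReal.ofReal (C * ‖x‖ ^ 2) + ENNReal.ofReal (C * ‖y‖ ^ 2) := by
        rw [lintegral_add_left hm]
        exact add_le_add (h x) (h y)
    _ = _ := by
        rw [← ENNReal.ofReal_add (by positivity) (by positivity), mul_add]

lemma integrable_phaseDensity_rankOne (x y : L2R) :
    Integrable (phaseDensity σ (rankOne ℂ x y)) := by
  obtain ⟨C, -, h⟩ := exists_lintegral_phaseDensity_rankOne_le hσ
  exact ⟨(contDiff_phaseDensity hσ _).continuous.aestronglyMeasurable,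
    (h x y).trans_lt ENNReal.ofReal_lt_top⟩

/-- The density of a rank-one operator as an element of `L¹`. -/
def rankOneDensity (x y : L2R) : (ℝ × ℝ) →₁[volume] ℝ :=
  (integrable_phaseDensity_rankOne hσ x y).toL1 (phaseDensity σ (rankOne ℂ x y))

end

lemma phaseDensity_add (σ : ℝ) (V V' : L2R →L[ℂ] L2R) :
    phaseDensity σ (V + V') = phaseDensity σ V + phaseDensity σ V' := by
  funext ⟨q, p⟩
  simp only [phaseDensity_eq_inner, add_apply, inner_add_right, Complex.add_re, Pi.add_apply]
  ring

lemma phaseDensity_smul (σ : ℝ) (c : ℝ) (V : L2R →L[ℂ] L2R) :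
    phaseDensity σ ((c : ℂ) • V) = c • phaseDensity σ V := by
  funext ⟨q, p⟩
  simp only [phaseDensity_eq_inner, smul_apply, inner_smul_right, Complex.re_ofReal_mul,
    Pi.smul_apply, smul_eq_mul]
  ring

lemma phaseDensity_zero (σ : ℝ) : phaseDensity σ 0 = 0 := by
  funext ⟨q, p⟩
  simp [phaseDensity_eq_inner]

lemma phaseDensity_sum_smul (σ : ℝ) {ι : Type*} (s : Finset ι) (c : ι → ℝ)
    (V : ι → L2R →L[ℂ] L2R) :
    phaseDensity σ (∑ i ∈ s, (c i : ℂ) • V i) = ∑ i ∈ s, c i • phaseDensity σ (V i) := by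
  classical
  induction s using Finset.induction_on with
  | empty => simp [phaseDensity_zero]
  | insert i s hi ih => rw [Finset.sum_insert hi, Finset.sum_insert hi, phaseDensity_add, ih,
      phaseDensity_smul]

section

variable {σ : ℝ} (hσ : 0 < σ)
include hσ

/-- This reduces differentiability of `ρ_t` in `L¹` to that of `exp(-iHt)ψ` in `L²`. -/
lemma isBoundedBilinearMap_rankOneDensity :
    IsBoundedBilinearMap ℝ fun x : L2R × L2R => rankOneDensity hσ x.1 x.2 := by
  have add_left : ∀ x y z : L2R, rankOneDensity hσ (x + y) z =
      rankOneDensity hσ x z + rankOneDensity hσ y z := fun x y z => by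
    rw [rankOneDensity, rankOneDensity, rankOneDensity, ← Integrable.toL1_add]
    refine toL1_congr _ _ ?_
    rw [← phaseDensity_add]
    simp
  have add_right : ∀ x y z : L2R, rankOneDensity hσ x (y + z) =
      rankOneDensity hσ x y + rankOneDensity hσ x z := fun x y z => by
    rw [rankOneDensity, rankOneDensity, rankOneDensity, ← Integrable.toL1_add]
    refine toL1_congr _ _ ?_
    rw [← phaseDensity_add]
    simp
  have smul_left : ∀ (c : ℝ) (x y : L2R), rankOneDensity hσ (c • x) y =
      c • rankOneDensity hσ x y := fun c x y => by
    rw [rankOneDensity, rankOneDensity, ← Integrable.toL1_smul]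
    refine toL1_congr _ _ ?_
    refine Eq.trans (congrArg _ ?_) (phaseDensity_smul σ c _)
    exact isBoundedBilinearMap_rankOne.smul_left c x y
  have smul_right : ∀ (c : ℝ) (x y : L2R), rankOneDensity hσ x (c • y) =
      c • rankOneDensity hσ x y := fun c x y => by
    rw [rankOneDensity, rankOneDensity, ← Integrable.toL1_smul]
    refine toL1_congr _ _ ?_
    refine Eq.trans (congrArg _ ?_) (phaseDensity_smul σ c _)
    exact isBoundedBilinearMap_rankOne.smul_right c x y
  refine ⟨add_left, smul_left, add_right, smul_right, ?_⟩
  obtain ⟨C, hC, h⟩ := exists_lintegral_phaseDensity_rankOne_le hσ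
  have hn : ∀ x y, ‖rankOneDensity hσ x y‖ ≤ C * (‖x‖ ^ 2 + ‖y‖ ^ 2) := fun x y => by
    rw [rankOneDensity, Integrable.norm_toL1_eq_lintegral_enorm]
    exact ENNReal.toReal_le_of_le_ofReal (by positivity) (h x y)
  -- On unit vectors the bound `C(‖x‖² + ‖y‖²)` reads `2C`, and homogeneity extends it; the added
  -- `1` keeps the constant strictly positive.
  refine ⟨2 * C + 1, by positivity, fun x y => ?_⟩
  have hunit : ∀ x : L2R, x ≠ 0 → ∃ u : L2R, ‖u‖ = 1 ∧ x = ‖x‖ • u := fun x hx =>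
    ⟨‖x‖⁻¹ • x, by rw [norm_smul, norm_inv, norm_norm, inv_mul_cancel₀ (norm_ne_zero_iff.2 hx)],
      by rw [smul_inv_smul₀ (norm_ne_zero_iff.2 hx)]⟩
  rcases eq_or_ne x 0 with rfl | hx
  · have := smul_left 0 0 y
    rw [zero_smul, zero_smul] at this
    simp [this]
  rcases eq_or_ne y 0 with rfl | hy
  · have := smul_right 0 x 0
    rw [zero_smul, zero_smul] at this
    simp [this]
  obtain ⟨u, hu, hxu⟩ := hunit x hx
  obtain ⟨v, hv, hyv⟩ := hunit y hy
  have h1 := hn u v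
  rw [hu, hv] at h1
  calc ‖rankOneDensity hσ x y‖ = ‖x‖ * ‖y‖ * ‖rankOneDensity hσ u v‖ := by
        conv_lhs => rw [hxu, hyv]
        rw [smul_left, smul_right, norm_smul, norm_smul, norm_norm, norm_norm, mul_assoc]
    _ ≤ ‖x‖ * ‖y‖ * (2 * C + 1) := by
        gcongr
        linarith
    _ = (2 * C + 1) * ‖x‖ * ‖y‖ := by ring

end

/-! ### Mixtures of vectors in the domain of the Hamiltonian -/

/-- The mixture `∑ α i |ψ i⟩⟨ψ i|`. -/
def mixture {n : ℕ} (α : Fin n → ℝ) (ψ : Fin n → L2R) : L2R →L[ℂ] L2R :=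
  ∑ i, (α i : ℂ) • rankOne ℂ (ψ i) (ψ i)

/-- The operator `∑ α i (|ψ i⟩⟨-i χ i| + |-i χ i⟩⟨ψ i|)`, which is `-i [H, W]` for the mixture `W`
of the `ψ i` when `χ i = H ψ i`. -/
def mixtureDeriv {n : ℕ} (α : Fin n → ℝ) (ψ χ : Fin n → L2R) : L2R →L[ℂ] L2R :=
  ∑ i, (α i : ℂ) • (rankOne ℂ (ψ i) (-Complex.I • χ i) + rankOne ℂ (-Complex.I • χ i) (ψ i))

lemma mixtureDeriv_eq {n : ℕ} (α : Fin n → ℝ) (ψ χ : Fin n → L2R) :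
    mixtureDeriv α ψ χ = ∑ i, (α i : ℂ) • rankOne ℂ (ψ i) (-Complex.I • χ i) +
      ∑ i, (α i : ℂ) • rankOne ℂ (-Complex.I • χ i) (ψ i) := by
  simp only [mixtureDeriv, smul_add, Finset.sum_add_distrib]

lemma isSelfAdjoint_mixture {n : ℕ} (α : Fin n → ℝ) (ψ : Fin n → L2R) :
    IsSelfAdjoint (mixture α ψ) := by
  rw [ContinuousLinearMap.isSelfAdjoint_iff', mixture, map_sum]
  refine Finset.sum_congr rfl fun i _ => ?_
  rw [map_smulₛₗ, adjoint_rankOne, Complex.conj_ofReal]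

lemma isSelfAdjoint_mixtureDeriv {n : ℕ} (α : Fin n → ℝ) (ψ χ : Fin n → L2R) :
    IsSelfAdjoint (mixtureDeriv α ψ χ) := by
  rw [ContinuousLinearMap.isSelfAdjoint_iff', mixtureDeriv, map_sum]
  refine Finset.sum_congr rfl fun i _ => ?_
  rw [map_smulₛₗ, map_add, adjoint_rankOne, adjoint_rankOne, Complex.conj_ofReal, add_comm]

lemma mixture_apply_eq_zero {n : ℕ} (α : Fin n → ℝ) {ψ : Fin n → L2R} {z : L2R}
    (h : ∀ i, ⟪ψ i, z⟫_ℂ = 0) : mixture α ψ z = 0 := by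
  rw [mixture, _root_.sum_apply]
  exact Finset.sum_eq_zero fun i _ => by
    rw [smul_apply, rankOne_apply, h i, zero_smul, smul_zero]

lemma mixtureDeriv_apply_eq_zero {n : ℕ} (α : Fin n → ℝ) {ψ χ : Fin n → L2R} {z : L2R}
    (h : ∀ i, ⟪ψ i, z⟫_ℂ = 0) (h' : ∀ i, ⟪χ i, z⟫_ℂ = 0) : mixtureDeriv α ψ χ z = 0 := by
  rw [mixtureDeriv, _root_.sum_apply]
  refine Finset.sum_eq_zero fun i _ => ?_
  rw [smul_apply, add_apply, rankOne_apply, rankOne_apply, inner_smul_left, h i, h' i]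
  simp

lemma mixture_mem {n : ℕ} (α : Fin n → ℝ) (ψ : Fin n → L2R) :
    mixture α ψ ∈ selfAdjointTraceClass L2R :=
  ⟨isSelfAdjoint_mixture α ψ, (traceNorm_le_of_forall_inner ψ fun _ hz =>
    mixture_apply_eq_zero α hz).trans_lt
      (ENNReal.mul_lt_top ENNReal.ofReal_lt_top (ENNReal.natCast_lt_top _))⟩

lemma mixtureDeriv_mem {n : ℕ} (α : Fin n → ℝ) (ψ χ : Fin n → L2R) :
    mixtureDeriv α ψ χ ∈ selfAdjointTraceClass L2R :=
  ⟨isSelfAdjoint_mixtureDeriv α ψ χ, (traceNorm_le_of_forall_inner (Sum.elim ψ χ) fun _ hz =>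
    mixtureDeriv_apply_eq_zero α (fun i => hz (.inl i)) fun i => hz (.inr i)).trans_lt
      (ENNReal.mul_lt_top ENNReal.ofReal_lt_top (ENNReal.natCast_lt_top _))⟩

section

variable {m ω : ℝ} (hm : 0 < m) (hω : 0 < ω) {n : ℕ} (α : Fin n → ℝ) {ψ χ : Fin n → L2R}

lemma dynamics_mixture (t : ℝ) (ψ : Fin n → L2R) :
    dynamics hm hω t (mixture α ψ) = mixture α fun i => evolution hm hω t (ψ i) :=
  dynamics_sum_smul_rankOne hm hω t _ ψ ψ

/-- The generator of the dynamics on mixtures of vectors in the domain of the Hamiltonian. -/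
lemma generatorGraph_mixture
    (h : ∀ i n, ⟪hermiteKet (groundScale m ω) n, χ i⟫_ℂ =
      energy ω n * ⟪hermiteKet (groundScale m ω) n, ψ i⟫_ℂ) :
    GeneratorGraph (dynamics hm hω) (mixture α ψ) (mixtureDeriv α ψ χ) := by
  refine ⟨mixture_mem α ψ, mixtureDeriv_mem α ψ χ, ?_⟩
  have hd : HasDerivAt (fun t => dynamics hm hω t (mixture α ψ)) (mixtureDeriv α ψ χ) 0 := by
    have he : (fun t => dynamics hm hω t (mixture α ψ)) = fun t => ∑ i, (α i : ℂ) •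
        rankOne ℂ (evolution hm hω t (ψ i)) (evolution hm hω t (ψ i)) :=
      funext fun t => dynamics_mixture hm hω α t ψ
    rw [he]
    have := HasDerivAt.fun_sum (u := Finset.univ) fun i (_ : i ∈ Finset.univ) =>
      (hasDerivAt_of_isBoundedBilinearMap isBoundedBilinearMap_rankOne
        (hasDerivAt_evolution_zero hm hω (h i))).const_smul (α i : ℂ)
    simpa only [evolution_zero] using! this
  rw [hasDerivAt_iff_tendsto_slope_zero, tendsto_iff_norm_sub_tendsto_zero] at hd
  have h0 : dynamics hm hω 0 (mixture α ψ) = mixture α ψ := by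
    simp only [dynamics_mixture, evolution_zero]
  -- The error operator annihilates whatever is orthogonal to the `3n` vectors `exp(-iHt)ψ i`, `ψ
  -- i`, `χ i`, so its trace norm is at most `3n` times its operator norm.
  have hlim : Tendsto (fun t : ℝ => ENNReal.ofReal ‖((t : ℂ)⁻¹) • (dynamics hm hω t (mixture α ψ) -
      mixture α ψ) - mixtureDeriv α ψ χ‖ * (Fintype.card (Fin n ⊕ Fin n ⊕ Fin n) : ℝ≥0∞))
      (𝓝[≠] 0) (𝓝 0) := by
    have h1 := ENNReal.Tendsto.mul_const (b := (Fintype.card (Fin n ⊕ Fin n ⊕ Fin n) : ℝ≥0∞))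
      ((ENNReal.continuous_ofReal.tendsto 0).comp hd) (Or.inr (ENNReal.natCast_ne_top _))
    rw [ENNReal.ofReal_zero, zero_mul] at h1
    refine h1.congr fun t => ?_
    simp only [Function.comp]
    rw [zero_add, h0, ← Complex.ofReal_inv, Complex.coe_smul]
    rfl
  refine tendsto_of_tendsto_of_tendsto_of_le_of_le tendsto_const_nhds hlim (fun _ => zero_le)
    fun t => ?_
  refine traceNorm_le_of_forall_inner
    (Sum.elim (fun i => evolution hm hω t (ψ i)) (Sum.elim ψ χ)) fun z hz => ?_
  have h1 : mixture α (fun i => evolution hm hω t (ψ i)) z = 0 :=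
    mixture_apply_eq_zero α fun i => hz (.inl i)
  have h2 : mixture α ψ z = 0 := mixture_apply_eq_zero α fun i => hz (.inr (.inl i))
  have h3 : mixtureDeriv α ψ χ z = 0 :=
    mixtureDeriv_apply_eq_zero α (fun i => hz (.inr (.inl i))) fun i => hz (.inr (.inr i))
  rw [dynamics_mixture, sub_apply, smul_apply, sub_apply, h1, h2, h3]
  simp

-- Symmetry of `H`: the eigenvalues are real, so the Parseval sums of `⟨ψ, H A⟩` and `⟨Hψ, A⟩` agree
-- term by term.
include hm hω in
lemma inner_hamiltonianCoherentVec {σ : ℝ} (hσ : 0 < σ) {ψ χ : L2R}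
    (h : ∀ n, ⟪hermiteKet (groundScale m ω) n, χ⟫_ℂ =
      energy ω n * ⟪hermiteKet (groundScale m ω) n, ψ⟫_ℂ) (t : ℂ) :
    ⟪ψ, hamiltonianCoherentVec m ω σ t⟫_ℂ = ⟪χ, coherentVec σ t⟫_ℂ := by
  have hb := groundScale_pos hm hω
  refine ((hermiteBasis hb).hasSum_inner_mul_inner ψ _).unique
    (((hermiteBasis hb).hasSum_inner_mul_inner χ (coherentVec σ t)).congr_fun fun n => ?_)
  rw [hermiteBasis_apply, ← energy_mul_inner_coherentVec hm hω hσ, ← inner_conj_symm χ, h,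
    map_mul, inner_conj_symm, Complex.conj_ofReal]
  ring

-- Once `H` is moved onto the `ψ i`, with `a = ⟨χ i, A⟩` and `b = ⟨A, ψ i⟩`, the claim is `-2 Im(ab)
-- = Re(iab + conj(iab))`.
include hm hω in
lemma correctedLiouville_mixture {σ : ℝ} (hσ : 0 < σ)
    (h : ∀ i n, ⟪hermiteKet (groundScale m ω) n, χ i⟫_ℂ =
      energy ω n * ⟪hermiteKet (groundScale m ω) n, ψ i⟫_ℂ) :
    correctedLiouville m ω σ (phaseDensity σ (mixture α ψ)) =
      phaseDensity σ (mixtureDeriv α ψ χ) := by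
  funext ⟨q, p⟩
  rw [correctedLiouville_phaseDensity hm hσ (isSelfAdjoint_mixture α ψ), phaseDensity_eq hσ]
  congr 2
  rw [coherentForm, mixture, mixtureDeriv, _root_.sum_apply, _root_.sum_apply, inner_sum, inner_sum,
    Complex.im_sum, Complex.re_sum, Finset.mul_sum]
  refine Finset.sum_congr rfl fun i _ => ?_
  rw [smul_apply, smul_apply, add_apply, rankOne_apply, rankOne_apply, rankOne_apply,
    inner_hamiltonianCoherentVec hm hω hσ (h i), inner_smul_right, inner_smul_right,
    inner_smul_right, inner_add_right, inner_smul_right, inner_smul_right, inner_smul_right,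
    inner_smul_left, ← inner_conj_symm (coherentVec _ _) (χ i),
    ← inner_conj_symm (ψ i) (coherentVec _ _)]
  generalize ⟪χ i, coherentVec σ (amplitude σ q p)⟫_ℂ = a
  generalize ⟪coherentVec σ (amplitude σ q p), ψ i⟫_ℂ = b
  simp only [Complex.im_ofReal_mul, Complex.re_ofReal_mul]
  rw [mul_left_comm]
  congr 1
  simp
  ring

lemma liouvilleGraph_mixture {σ : ℝ} (hσ : 0 < σ) (hψ : ∀ i, ψ i ∈ hamiltonianDomain m ω) :
    LiouvilleGraph hm hω σ (phaseDensity σ (mixture α ψ))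
      (correctedLiouville m ω σ (phaseDensity σ (mixture α ψ))) := by
  choose χ hχ using fun i => exists_inner_eq_energy_mul hm hω (hψ i)
  exact ⟨_, _, generatorGraph_mixture hm hω α hχ, rfl,
    (correctedLiouville_mixture hm hω α hσ hχ).symm⟩

end

/-! ### Integrability of densities and the equation of motion in `L¹` -/

section

variable {σ : ℝ} (hσ : 0 < σ)
include hσ

lemma integrable_phaseDensity_sum {ι : Type*} (s : Finset ι) (c : ι → ℝ) (x y : ι → L2R) :
    Integrable (phaseDensity σ (∑ i ∈ s, (c i : ℂ) • rankOne ℂ (x i) (y i))) := by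
  rw [phaseDensity_sum_smul]
  exact integrable_finsetSum' _ fun i _ => (integrable_phaseDensity_rankOne hσ _ _).smul _

lemma toL1_phaseDensity_sum {ι : Type*} (s : Finset ι) (c : ι → ℝ) (x y : ι → L2R) :
    (integrable_phaseDensity_sum hσ s c x y).toL1 _ =
      ∑ i ∈ s, c i • rankOneDensity hσ (x i) (y i) := by
  classical
  induction s using Finset.induction_on with
  | empty =>
    refine (toL1_congr _ (integrable_zero (ℝ × ℝ) ℝ volume)
      (by rw [Finset.sum_empty, phaseDensity_zero])).trans ?_
    rw [Finset.sum_empty]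
    exact Integrable.toL1_zero _
  | insert i s hi ih =>
    refine (toL1_congr _ (((integrable_phaseDensity_rankOne hσ (x i) (y i)).smul (c i)).add
      (integrable_phaseDensity_sum hσ s c x y))
      (by rw [Finset.sum_insert hi, phaseDensity_add, phaseDensity_smul])).trans ?_
    rw [Finset.sum_insert hi, ← ih, rankOneDensity, ← Integrable.toL1_smul, ← Integrable.toL1_add]
    rfl

lemma integrable_phaseDensity_mixtureDeriv {n : ℕ} (α : Fin n → ℝ) (ψ χ : Fin n → L2R) :
    Integrable (phaseDensity σ (mixtureDeriv α ψ χ)) := by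
  rw [mixtureDeriv_eq, phaseDensity_add]
  exact (integrable_phaseDensity_sum hσ _ _ _ _).add (integrable_phaseDensity_sum hσ _ _ _ _)

lemma toL1_phaseDensity_mixtureDeriv {n : ℕ} (α : Fin n → ℝ) (ψ χ : Fin n → L2R) :
    (integrable_phaseDensity_mixtureDeriv hσ α ψ χ).toL1 _ =
      ∑ i, α i • (rankOneDensity hσ (ψ i) (-Complex.I • χ i) +
        rankOneDensity hσ (-Complex.I • χ i) (ψ i)) := by
  simp only [smul_add, Finset.sum_add_distrib]
  rw [← toL1_phaseDensity_sum hσ, ← toL1_phaseDensity_sum hσ, ← Integrable.toL1_add]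
  exact toL1_congr _ _ (by rw [mixtureDeriv_eq, phaseDensity_add])

/-- The equation of motion in `L¹` for mixtures of vectors in the domain of the Hamiltonian. -/
lemma hasDerivAt_toL1_phaseDensity {m ω : ℝ} (hm : 0 < m) (hω : 0 < ω) {n : ℕ} (α : Fin n → ℝ)
    {ψ : Fin n → L2R} (hψ : ∀ i, ψ i ∈ hamiltonianDomain m ω) :
    ∃ (hρ : ∀ t : ℝ, Integrable (phaseDensity σ (dynamics hm hω t (mixture α ψ))) volume)
      (hL : ∀ t : ℝ, Integrable
        (correctedLiouville m ω σ (phaseDensity σ (dynamics hm hω t (mixture α ψ)))) volume),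
      ∀ t : ℝ, HasDerivAt
        (fun s : ℝ => (hρ s).toL1 (phaseDensity σ (dynamics hm hω s (mixture α ψ))))
        ((hL t).toL1 (correctedLiouville m ω σ
          (phaseDensity σ (dynamics hm hω t (mixture α ψ))))) t := by
  -- The evolution preserves `D(H)`, so `χ t i`, which is `H` applied to the evolved vector, exists
  -- at every time.
  choose χ hχ using fun t i =>
    exists_inner_eq_energy_mul hm hω (evolution_mem_hamiltonianDomain hm hω (hψ i) t)
  have hLe : ∀ t, correctedLiouville m ω σ (phaseDensity σ (dynamics hm hω t (mixture α ψ))) =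
      phaseDensity σ (mixtureDeriv α (fun i => evolution hm hω t (ψ i)) (χ t)) := fun t => by
    rw [dynamics_mixture]
    exact correctedLiouville_mixture hm hω α hσ (hχ t)
  have hρ : ∀ t : ℝ, Integrable (phaseDensity σ (dynamics hm hω t (mixture α ψ))) := fun t => by
    rw [dynamics_mixture]
    exact integrable_phaseDensity_sum hσ _ _ _ _
  have hL : ∀ t : ℝ, Integrable (correctedLiouville m ω σ
      (phaseDensity σ (dynamics hm hω t (mixture α ψ)))) := fun t => by
    rw [hLe]
    exact integrable_phaseDensity_mixtureDeriv hσ _ _ _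
  refine ⟨hρ, hL, fun t => ?_⟩
  have h1 : ∀ s, (hρ s).toL1 (phaseDensity σ (dynamics hm hω s (mixture α ψ))) =
      ∑ i, α i • rankOneDensity hσ (evolution hm hω s (ψ i)) (evolution hm hω s (ψ i)) := fun s => by
    rw [← toL1_phaseDensity_sum hσ]
    exact toL1_congr _ _ (by rw [dynamics_mixture]; rfl)
  have h2 : (hL t).toL1 _ = ∑ i, α i • (rankOneDensity hσ (evolution hm hω t (ψ i))
      (-Complex.I • χ t i) + rankOneDensity hσ (-Complex.I • χ t i) (evolution hm hω t (ψ i))) := by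
    rw [← toL1_phaseDensity_mixtureDeriv hσ]
    exact toL1_congr _ _ (hLe t)
  simp only [h1]
  rw [h2]
  exact HasDerivAt.fun_sum fun i _ =>
    (hasDerivAt_of_isBoundedBilinearMap (isBoundedBilinearMap_rankOneDensity hσ)
      (hasDerivAt_evolution hm hω t (hχ t i))).const_smul (α i)

end

/-! ### The case in which the coherent state is the ground state -/

section

variable {m ω : ℝ} (hm : 0 < m) (hω : 0 < ω)

/-- At this length scale the coherent vector is a series in the eigenfunctions: the phases
`exp(-iωnt)` are absorbed into `z^n`, and the zero-point energy `ω/2` leaves a global phase. -/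
lemma evolution_coherentVec (t : ℝ) (z : ℂ) :
    evolution hm hω t (coherentVec (groundScale m ω) z) =
      Complex.exp (((-(ω * t / 2) : ℝ) : ℂ) * Complex.I) •
        coherentVec (groundScale m ω) (Complex.exp (((-(ω * t) : ℝ) : ℂ) * Complex.I) * z) := by
  refine ext_inner_hermiteKet (groundScale_pos hm hω) fun n => ?_
  rw [inner_evolution, inner_smul_right, inner_hermiteKet_coherentVec (groundScale_pos hm hω),
    inner_hermiteKet_coherentVec (groundScale_pos hm hω), mul_pow, ← Complex.exp_nat_mul,
    ← mul_div_assoc, ← mul_div_assoc, ← mul_assoc, ← Complex.exp_add, energy]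
  congr 3
  push_cast
  ring

lemma dynamics_add (s t : ℝ) (W : L2R →L[ℂ] L2R) :
    dynamics hm hω (s + t) W = dynamics hm hω s (dynamics hm hω t W) := by
  ext1 x
  simp only [dynamics, ContinuousLinearMap.comp_apply]
  rw [evolution_add, neg_add_rev, evolution_add]

/-- The Gaussian weight depends only on the modulus of the amplitude, which rotation preserves, and
the global phases cancel between bra and ket. -/
lemma phaseDensity_dynamics (t : ℝ) (W : L2R →L[ℂ] L2R) {q p q' p' : ℝ}
    (h : amplitude (groundScale m ω) q' p' =
      Complex.exp (((ω * t : ℝ) : ℂ) * Complex.I) * amplitude (groundScale m ω) q p) :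
    phaseDensity (groundScale m ω) (dynamics hm hω t W) (q, p) =
      phaseDensity (groundScale m ω) W (q', p') := by
  have hs := groundScale_pos hm hω
  rw [phaseDensity_eq hs, phaseDensity_eq hs, gaussWeight_eq, gaussWeight_eq, h, norm_mul,
    Complex.norm_exp_ofReal_mul_I, one_mul, dynamics, ContinuousLinearMap.comp_apply,
    ContinuousLinearMap.comp_apply, ← neg_neg t, ← inner_evolution_left, neg_neg,
    evolution_coherentVec, map_smul, inner_smul_left, inner_smul_right, ← mul_assoc (starRingEnd ℂ _),
    Complex.conj_mul', Complex.norm_exp_ofReal_mul_I]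
  simp

/-- The inverse of the classical flow of the oscillator. -/
def inverseFlow (m ω t : ℝ) (x : ℝ × ℝ) : ℝ × ℝ :=
  (x.1 * Real.cos (ω * t) - x.2 / (m * ω) * Real.sin (ω * t),
    x.2 * Real.cos (ω * t) + m * ω * x.1 * Real.sin (ω * t))

include hm hω

lemma amplitude_inverseFlow (t : ℝ) (x : ℝ × ℝ) :
    amplitude (groundScale m ω) (inverseFlow m ω t x).1 (inverseFlow m ω t x).2 =
      Complex.exp (((ω * t : ℝ) : ℂ) * Complex.I) * amplitude (groundScale m ω) x.1 x.2 := by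
  have hs := groundScale_pos hm hω
  set s := groundScale m ω with hsdef
  have hms : m = 1 / (2 * ω * s ^ 2) := by
    rw [hsdef, groundScale, div_pow, Real.sq_sqrt (by positivity)]
    field_simp
  have hs' : (s : ℂ) ≠ 0 := by exact_mod_cast hs.ne'
  have hω' : (ω : ℂ) ≠ 0 := by exact_mod_cast hω.ne'
  rw [Complex.exp_mul_I, amplitude, amplitude, inverseFlow, hms]
  push_cast
  field_simp
  linear_combination (-2 * s ^ 2 * x.2 * Complex.sin (ω * t)) * Complex.I_sq

lemma phaseDensity_dynamics_eq_inverseFlow (t : ℝ) (W : L2R →L[ℂ] L2R) (x : ℝ × ℝ) :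
    phaseDensity (groundScale m ω) (dynamics hm hω t W) x =
      phaseDensity (groundScale m ω) W (inverseFlow m ω t x) :=
  phaseDensity_dynamics hm hω t W (amplitude_inverseFlow hm hω t x)

/-- Undoing an arbitrary solution by the explicit rotation gives a curve with zero derivative; this
replaces an appeal to uniqueness for differential equations. -/
lemma inverseFlow_apply_flow {Φ : ℝ → ℝ × ℝ ≃ ℝ × ℝ}
    (hΦ : IsHamiltonianFlow (classicalHamiltonian m ω) Φ) (t : ℝ) (x : ℝ × ℝ) :
    inverseFlow m ω t (Φ t x) = x := by
  have hd : ∀ t, HasDerivAt (fun t => inverseFlow m ω t (Φ t x)) 0 t := fun t => by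
    have h := (hΦ x).2 t
    rw [dp_classicalHamiltonian, dq_classicalHamiltonian] at h
    have h1 : HasDerivAt (fun t => (Φ t x).1) ((Φ t x).2 / m) t :=
      (ContinuousLinearMap.fst ℝ ℝ ℝ).hasFDerivAt.comp_hasDerivAt t h
    have h2 : HasDerivAt (fun t => (Φ t x).2) (-(m * ω ^ 2 * (Φ t x).1)) t :=
      (ContinuousLinearMap.snd ℝ ℝ ℝ).hasFDerivAt.comp_hasDerivAt t h
    have hl : HasDerivAt (fun s : ℝ => ω * s) ω t := by simpa using (hasDerivAt_id t).const_mul ω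
    have hs := hl.sin
    have hc := hl.cos
    have k1 := (h1.mul hc).sub ((h2.div_const (m * ω)).mul hs)
    have k2 := (h2.mul hc).add ((h1.const_mul (m * ω)).mul hs)
    refine (k1.prodMk k2).congr_deriv ?_
    ext
    · simp only [Prod.fst_zero]
      field_simp
      ring
    · simp only [Prod.snd_zero]
      field_simp
      ring
  have hconst := is_const_of_deriv_eq_zero (f := fun t => inverseFlow m ω t (Φ t x))
    (fun t => (hd t).differentiableAt) (fun t => (hd t).deriv) t 0
  have h0 : inverseFlow m ω 0 x = x := by simp [inverseFlow]
  simpa [(hΦ x).1, h0] using hconst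

lemma hasDerivAt_inverseFlow_zero (x : ℝ × ℝ) :
    HasDerivAt (fun t => inverseFlow m ω t x) (-(x.2 / m), m * ω ^ 2 * x.1) 0 := by
  have hl : HasDerivAt (fun s : ℝ => ω * s) ω 0 := by simpa using (hasDerivAt_id (0 : ℝ)).const_mul ω
  have hs := hl.sin
  have hc := hl.cos
  have k1 := (hc.const_mul x.1).sub (hs.const_mul (x.2 / (m * ω)))
  have k2 := (hc.const_mul x.2).add (hs.const_mul (m * ω * x.1))
  refine (k1.prodMk k2).congr_deriv ?_
  ext
  · simp
    field_simp
  · simp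
    ring

/-- By the group law `ρ_s` is `ρ_t` composed with the inverse flow for time `s - t`, whose initial
velocity is `(-∂H/∂p, ∂H/∂q)`; the chain rule produces the bracket. -/
lemma hasDerivAt_phaseDensity_dynamics (W : L2R →L[ℂ] L2R) (t : ℝ) (x : ℝ × ℝ) :
    HasDerivAt (fun s => phaseDensity (groundScale m ω) (dynamics hm hω s W) x)
      (-poisson (classicalHamiltonian m ω)
        (phaseDensity (groundScale m ω) (dynamics hm hω t W)) x) t := by
  have hs := groundScale_pos hm hω
  set ρ := phaseDensity (groundScale m ω) (dynamics hm hω t W) with hρ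
  have hdiff : Differentiable ℝ ρ := (contDiff_phaseDensity hs _).differentiable (by simp)
  have hfd := (hdiff x).hasFDerivAt
  have hdq : dq ρ x = fderiv ℝ ρ x (1, 0) :=
    (HasFDerivAt.comp_hasDerivAt (f := fun q => (q, x.2)) x.1 hfd
      ((hasDerivAt_id x.1).prodMk (hasDerivAt_const x.1 x.2))).deriv
  have hdp : dp ρ x = fderiv ℝ ρ x (0, 1) :=
    (HasFDerivAt.comp_hasDerivAt (f := fun p => (x.1, p)) x.2 hfd
      ((hasDerivAt_const x.2 x.1).prodMk (hasDerivAt_id x.2))).deriv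
  have hflow : HasDerivAt (fun s => inverseFlow m ω (s - t) x) (-(x.2 / m), m * ω ^ 2 * x.1) t := by
    have := HasDerivAt.scomp_of_eq (h := fun r : ℝ => r - t) t
      (hasDerivAt_inverseFlow_zero hm hω x) ((hasDerivAt_id t).sub_const t) (sub_self t).symm
    rwa [one_smul] at this
  have hx : inverseFlow m ω (t - t) x = x := by simp [inverseFlow]
  have hcomp := HasFDerivAt.comp_hasDerivAt_of_eq t hfd hflow hx.symm
  have hfun : (fun s => phaseDensity (groundScale m ω) (dynamics hm hω s W) x) =
      ρ ∘ fun s => inverseFlow m ω (s - t) x := funext fun s => by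
    conv_lhs => rw [← sub_add_cancel s t, dynamics_add]
    exact phaseDensity_dynamics_eq_inverseFlow hm hω _ _ x
  rw [hfun]
  refine hcomp.congr_deriv ?_
  rw [poisson, dq_classicalHamiltonian, dp_classicalHamiltonian, hdq, hdp]
  have hv : ((-(x.2 / m), m * ω ^ 2 * x.1) : ℝ × ℝ) =
      (-(x.2 / m)) • ((1, 0) : ℝ × ℝ) + (m * ω ^ 2 * x.1) • ((0, 1) : ℝ × ℝ) := by
    ext <;> simp
  rw [hv, map_add, map_smul, map_smul, smul_eq_mul, smul_eq_mul]
  ring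

end

end PhaseSpace

end

theorem proposition7p12 (m ω σ : ℝ) (hm : 0 < m) (hω : 0 < ω) (hσ : 0 < σ) :
    -- `T̂` is injective on `T_s`, so that `T̂⁻¹` and `L̂ = T̂ Z T̂⁻¹` make sense
    (∀ V ∈ selfAdjointTraceClass L2R, ∀ V' ∈ selfAdjointTraceClass L2R,
      phaseDensity σ V =ᵐ[volume] phaseDensity σ V' → V = V') ∧
    -- finite convex combinations of pure states with vectors in `D(H)`
    (∀ (n : ℕ) (α : Fin n → ℝ) (ψ : Fin n → L2R),
      (∀ i, 0 ≤ α i) → ∑ i, α i = 1 → (∀ i, ‖ψ i‖ = 1) → (∀ i, ψ i ∈ hamiltonianDomain m ω) →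
      ∀ W : L2R →L[ℂ] L2R, W = ∑ i, ((α i : ℝ) : ℂ) • rankOne ℂ (ψ i) (ψ i) →
      -- `ρ ∈ D(L̂) ∩ C^∞` and `L̂ρ` is the differential expression
      (ContDiff ℝ (⊤ : ℕ∞) (phaseDensity σ W) ∧
        LiouvilleGraph hm hω σ (phaseDensity σ W) (correctedLiouville m ω σ (phaseDensity σ W))) ∧
      -- the same holds for `ρ_t`, for all `t`
      (∀ t : ℝ, ContDiff ℝ (⊤ : ℕ∞) (phaseDensity σ (dynamics hm hω t W)) ∧
        LiouvilleGraph hm hω σ (phaseDensity σ (dynamics hm hω t W))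
          (correctedLiouville m ω σ (phaseDensity σ (dynamics hm hω t W)))) ∧
      -- `ρ_t` solves the equation of motion, the time derivative being taken in `L¹`-norm
      ∃ (hρ : ∀ t : ℝ, Integrable (phaseDensity σ (dynamics hm hω t W)) volume)
        (hL : ∀ t : ℝ, Integrable
          (correctedLiouville m ω σ (phaseDensity σ (dynamics hm hω t W))) volume),
        ∀ t : ℝ, HasDerivAt
          (fun s : ℝ => (hρ s).toL1 (phaseDensity σ (dynamics hm hω s W)))
          ((hL t).toL1 (correctedLiouville m ω σ (phaseDensity σ (dynamics hm hω t W)))) t) ∧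
    -- the case in which the coherent state is the ground state
    (σ = 1 / √(2 * m * ω) →
      ∀ Φ : ℝ → ℝ × ℝ ≃ ℝ × ℝ, IsHamiltonianFlow (classicalHamiltonian m ω) Φ →
      ∀ W ∈ states L2R,
        (∀ t : ℝ, phaseDensity σ (dynamics hm hω t W) = phaseDensity σ W ∘ (Φ t).symm) ∧
        (ContDiff ℝ (⊤ : ℕ∞) (phaseDensity σ W) →
          ∀ (t : ℝ) (x : ℝ × ℝ),
            HasDerivAt (fun s : ℝ => phaseDensity σ (dynamics hm hω s W) x)
              (-poisson (classicalHamiltonian m ω) (phaseDensity σ (dynamics hm hω t W)) x) t)) := by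
  refine ⟨fun V hV V' hV' h => phaseDensity_injective hσ hV.1 hV'.1 h, ?_, ?_⟩
  · intro n α ψ _ _ _ hψ W hW
    obtain rfl : W = mixture α ψ := hW
    refine ⟨⟨contDiff_phaseDensity hσ _, liouvilleGraph_mixture hm hω α hσ hψ⟩, fun t =>
      ⟨contDiff_phaseDensity hσ _, ?_⟩, hasDerivAt_toL1_phaseDensity hσ hm hω α hψ⟩
    rw [dynamics_mixture]
    exact liouvilleGraph_mixture hm hω α hσ fun i =>
      evolution_mem_hamiltonianDomain hm hω (hψ i) t
  · intro hσ' Φ hΦ W _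
    obtain rfl : σ = groundScale m ω := hσ'
    refine ⟨fun t => funext fun x => ?_, fun _ => hasDerivAt_phaseDensity_dynamics hm hω W⟩
    -- Evaluated at `(Φ t).symm x`, `inverseFlow_apply_flow` identifies `inverseFlow` with the
    -- inverse of the given flow.
    rw [phaseDensity_dynamics_eq_inverseFlow hm hω, Function.comp_apply,
      ← inverseFlow_apply_flow hm hω hΦ t ((Φ t).symm x), Equiv.apply_symm_apply]
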